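/- Let $M$ be a real symmetric positive definite $n\times n$ matrix with distinct eigenvalues $0<\lambda_1<\lambda_2<\cdots<\lambda_p$ of multiplicities $h_1,\dots,h_p$ (so $h_1+\cdots+h_p=n$). Put $\mathcal{J}_M=\bigoplus_{i=1}^p\lambda_i I_{h_i}$ (block diagonal matrix), and let $Q\in\mathcal{O}_n$ be a real orthogonal matrix with $M=Q\mathcal{J}_MQ^T$. Fix integers $0\le u_i\le h_i$ ($1\le i\le p$), put $u=\sum_{i=1}^p u_i$ and $$\widetilde{\mathcal{J}}=\bigoplus_{i=1}^p\sqrt{\lambda_i}\,\bigl(I_{u_i}\oplus(-I_{h_i-u_i})\bigr).$$ For $N\in\{M,\mathcal{J}_M\}$ let $\mathcal{SSR}(N)_{(u_1,\dots,u_p)}$ be the set of all real symmetric matrices $Y$ with $Y^2=N$ such that, for every $i$, $\sqrt{\lambda_i}$ is an eigenvalue of $Y$ of multiplicity $u_i$ and $-\sqrt{\lambda_i}$ is an eigenvalue of $Y$ of multiplicity $h_i-u_i$ (multiplicity $0$ means that it is not an eigenvalue). Let $GLSym_m(q)$ be the set of nonsingular real symmetric $m\times m$ matrices with $q$ positive and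 $m-q$ negative eigenvalues (with multiplicity), let $\Gamma_Q(X)=QXQ^T$, and for a nonsingular matrix $B$ let $\mathcal{C}_B$ be the group of nonsingular real matrices commuting with $B$. For sets $\mathcal{S}_i$ of square matrices, $\bigoplus_i\mathcal{S}_i$ is the set of all block diagonal matrices $B_1\oplus\cdots\oplus B_p$ with $B_i\in\mathcal{S}_i$. Then: 1. $\mathcal{SSR}(M)_{(u_1,\dots,u_p)}=\{QX\widetilde{\mathcal{J}}X^TQ^T : X\in\mathcal{C}_{\mathcal{J}_M}\cap\mathcal{O}_n\}=\Gamma_Q\bigl(\mathcal{SSR}(\mathcal{J}_M)_{(u_1,\dots,u_p)}\bigr)$, and $$\mathcal{SSR}(\mathcal{J}_M)_{(u_1,\dots,u_p)}=\bigoplus_{i=1}^p\sqrt{\lambda_i}\,\bigl(\mathcal{O}_{h_i}\cap GLSym_{h_i}(u_i)\bigr).$$ 2. $GLSym_n(u)$ is open in the vector space of real symmetric $n\times n$ matrices, and $\mathcal{SSR}(M)_{(u_1,\dots,u_p)}$ is a compact embedded $C^\infty$ submanifold of $GLSym_n(u)$. Moreover $\mathcal{C}_{\widetilde{\mathcal{J}}}\cap\mathcal{O}_n\subseteq\mathcal{C}_{\mathcal{J}_M}\cap\mathcal{O}_n$,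 and $\mathcal{SSR}(M)_{(u_1,\dots,u_p)}$ is diffeomorphic to the homogeneous space $$\frac{\mathcal{C}_{\mathcal{J}_M}\cap\mathcal{O}_n}{\mathcal{C}_{\widetilde{\mathcal{J}}}\cap\mathcal{O}_n}.$$ Here $\mathcal{C}_{\mathcal{J}_M}\cap\mathcal{O}_n$ is an embedded submanifold of the space of real $n\times n$ matrices, and the quotient carries the quotient topology and the smooth structure for which the projection from $\mathcal{C}_{\mathcal{J}_M}\cap\mathcal{O}_n$ is a smooth submersion. -/

import Mathlib

open scoped Manifold ContDiff Pointwise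

-- The space of matrices carries the entrywise sup norm; smoothness does not depend on the choice.
attribute [local instance] Matrix.normedAddCommGroup Matrix.normedSpace

noncomputable section

namespace SymRoots

/-- `Sym_n`: the vector space of real symmetric `n × n` matrices. -/
def Sym (n : ℕ) : Submodule ℝ (Matrix (Fin n) (Fin n) ℝ) where
  carrier := {A | A.IsSymm}
  add_mem' ha hb := Matrix.IsSymm.add ha hb
  zero_mem' := Matrix.isSymm_zero
  smul_mem' c _ ha := Matrix.IsSymm.smul ha c

/-- A set of matrices, seen inside the vector space `Sym_n` (only its symmetric members count). -/
def inSym {n : ℕ} (S : Set (Matrix (Fin n) (Fin n) ℝ)) : Set (Sym n) :=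
  {A | (A : Matrix (Fin n) (Fin n) ℝ) ∈ S}

/-- `GLSym_n(q)`: nonsingular real symmetric matrices with `q` positive and `n - q` negative
eigenvalues, counted with multiplicity. -/
def GLSym (n q : ℕ) : Set (Matrix (Fin n) (Fin n) ℝ) :=
  {A | A.IsSymm ∧ IsUnit A ∧
    (A.charpoly.roots.filter (fun x => 0 < x)).card = q ∧
    (A.charpoly.roots.filter (fun x => x < 0)).card = n - q}

/-- `O_n` as a set of matrices. -/
def O (n : ℕ) : Set (Matrix (Fin n) (Fin n) ℝ) := {A | A ∈ Matrix.orthogonalGroup (Fin n) ℝ}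

/-- The block diagonal matrix `B₁ ⊕ ⋯ ⊕ B_p` of order `n = h₁ + ⋯ + h_p`, blocks in order. -/
def blockSum {p n : ℕ} {h : Fin p → ℕ} (hn : ∑ i, h i = n)
    (B : (i : Fin p) → Matrix (Fin (h i)) (Fin (h i)) ℝ) : Matrix (Fin n) (Fin n) ℝ :=
  Matrix.reindex (finSigmaFinEquiv.trans (finCongr hn)) (finSigmaFinEquiv.trans (finCongr hn))
    (Matrix.blockDiagonal' B)

/-- `S₁ ⊕ ⋯ ⊕ S_p` for sets of square matrices. -/
def blockSumSet {p n : ℕ} {h : Fin p → ℕ} (hn : ∑ i, h i = n)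
    (S : (i : Fin p) → Set (Matrix (Fin (h i)) (Fin (h i)) ℝ)) :
    Set (Matrix (Fin n) (Fin n) ℝ) :=
  {A | ∃ B : (i : Fin p) → Matrix (Fin (h i)) (Fin (h i)) ℝ,
    (∀ i, B i ∈ S i) ∧ A = blockSum hn B}

/-- `J_M = ⊕ λᵢ I_{hᵢ}`. -/
def jordanForm {p n : ℕ} {h : Fin p → ℕ} (hn : ∑ i, h i = n) (lam : Fin p → ℝ) :
    Matrix (Fin n) (Fin n) ℝ :=
  blockSum hn (fun i => lam i • (1 : Matrix (Fin (h i)) (Fin (h i)) ℝ))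

/-- `J̃ = ⊕ √λᵢ (I_{uᵢ} ⊕ (-I_{hᵢ-uᵢ}))`. -/
def auxForm {p n : ℕ} {h : Fin p → ℕ} (hn : ∑ i, h i = n) (lam : Fin p → ℝ) (u : Fin p → ℕ) :
    Matrix (Fin n) (Fin n) ℝ :=
  blockSum hn (fun i => √(lam i) •
    Matrix.diagonal (fun a : Fin (h i) => if (a : ℕ) < u i then (1 : ℝ) else -1))

/-- `SSR(M)`: the real symmetric square roots of `M`. -/
def SSR {n : ℕ} (M : Matrix (Fin n) (Fin n) ℝ) : Set (Matrix (Fin n) (Fin n) ℝ) :=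
  {Y | Y ^ 2 = M ∧ Y.IsSymm}

/-- `SSR(M)_{(u₁,…,u_p)}`: the symmetric square roots `Y` of `M` whose eigenvalues are `√λᵢ` with
multiplicity `uᵢ` and `-√λᵢ` with multiplicity `hᵢ - uᵢ`, where the `λᵢ` are the eigenvalues of `M`,
of multiplicity `hᵢ` (that is, `Y` has `J̃` as its real Jordan auxiliary form). -/
def stratum {n p : ℕ} (M : Matrix (Fin n) (Fin n) ℝ) (lam : Fin p → ℝ) (h u : Fin p → ℕ) :
    Set (Matrix (Fin n) (Fin n) ℝ) :=
  {Y | Y ∈ SSR M ∧ ∀ i, Y.charpoly.rootMultiplicity (√(lam i)) = u i ∧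
    Y.charpoly.rootMultiplicity (-√(lam i)) = h i - u i}

/-- The congruence `Γ_Q(X) = Q X Qᵀ`. -/
def congruence {n : ℕ} (Q X : Matrix (Fin n) (Fin n) ℝ) : Matrix (Fin n) (Fin n) ℝ :=
  Q * X * Q.transpose

/-- The group `C_B ∩ O_n` of orthogonal matrices that commute with `B`. -/
def orthCentralizer {n : ℕ} (B : Matrix (Fin n) (Fin n) ℝ) :
    Subgroup (Matrix.orthogonalGroup (Fin n) ℝ) where
  carrier := {X | Commute B (X : Matrix (Fin n) (Fin n) ℝ)}
  mul_mem' ha hb := Commute.mul_right ha hb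
  one_mem' := Commute.one_right B
  inv_mem' := by
    intro X hX
    have h1 : (X : Matrix (Fin n) (Fin n) ℝ) * ((X⁻¹ : Matrix.orthogonalGroup (Fin n) ℝ) :
        Matrix (Fin n) (Fin n) ℝ) = 1 := by
      rw [← Submonoid.coe_mul, mul_inv_cancel, Submonoid.coe_one]
    have h2 : ((X⁻¹ : Matrix.orthogonalGroup (Fin n) ℝ) : Matrix (Fin n) (Fin n) ℝ) *
        (X : Matrix (Fin n) (Fin n) ℝ) = 1 := by
      rw [← Submonoid.coe_mul, inv_mul_cancel, Submonoid.coe_one]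
    exact Commute.units_inv_right (u := ⟨_, _, h1, h2⟩) hX

/-- The inclusion of `C_B ∩ O_n` in the space of all matrices. -/
def orthIncl {n : ℕ} (B : Matrix (Fin n) (Fin n) ℝ) (X : orthCentralizer B) :
    Matrix (Fin n) (Fin n) ℝ := X.1.1

/-- A structure of smooth `d`-dimensional manifold on the topological space `X` for which the map
`f` into a normed space is a smooth embedding (an immersion and a homeomorphism onto its image).
For given `f` there is at most one such structure, up to passing to a compatible atlas; if `f` is
the inclusion of a subset, the subset is an embedded submanifold exactly if there is one. -/
structure EmbeddedStructure (d : ℕ) {X E : Type} [TopologicalSpace X] [NormedAddCommGroup E]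
    [NormedSpace ℝ E] (f : X → E) where
  charted : ChartedSpace (EuclideanSpace ℝ (Fin d)) X
  isManifold : IsManifold (𝓡 d) ∞ X
  isSmoothEmbedding : Manifold.IsSmoothEmbedding (𝓡 d) 𝓘(ℝ, E) ∞ f

/-- The manifold structure of a homogeneous space `G ⧸ H` (with the quotient topology), for a group
`G` with a given manifold structure: the one that makes the projection `G → G ⧸ H` a smooth
submersion. It is unique up to passing to a compatible atlas. -/
structure HomogeneousStructure (d k : ℕ) {G : Type} [Group G] [TopologicalSpace G]
    (cG : ChartedSpace (EuclideanSpace ℝ (Fin d)) G) (H : Subgroup G) where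
  charted : ChartedSpace (EuclideanSpace ℝ (Fin k)) (G ⧸ H)
  isManifold : IsManifold (𝓡 k) ∞ (G ⧸ H)
  isSubmersion : Manifold.IsSubmersion (𝓡 d) (𝓡 k) ∞ (QuotientGroup.mk : G → G ⧸ H)

/-- Two spaces with given smooth atlases are diffeomorphic. -/
def AreDiffeomorphic (k l : ℕ) {X Y : Type} [TopologicalSpace X] [TopologicalSpace Y]
    (cX : ChartedSpace (EuclideanSpace ℝ (Fin k)) X)
    (cY : ChartedSpace (EuclideanSpace ℝ (Fin l)) Y) : Prop :=
  Nonempty (X ≃ₘ^∞⟮𝓡 k, 𝓡 l⟯ Y)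

end SymRoots

end

/-! Write `J` for `J_M` and `T` for the auxiliary form, so that `T² = J` and `T` is invertible. A
symmetric `Y` lies in the stratum of `M` exactly when `Y² = M` and `Y` has the characteristic
polynomial of `T`, because the prescribed multiplicities already add up to `n`
(`charpoly_eq_auxForm_iff`). By the spectral theorem such a `Y` is `Q g T gᵀ Qᵀ` with `g`
orthogonal, and comparing squares forces `g` to commute with `J` (`exists_orthCentralizer_conj`). So
the stratum is one orbit of the compact group `C_J ∩ O_n`, and the fibres of the orbit map are the
cosets of `C_T ∩ O_n`. As the `λᵢ` are distinct, this group is block diagonal, and for `Q = 1` the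
orbit splits into blocks.

The manifold structures come from Cayley transforms. Near `g` the group is parametrized by `g (1 -
K)(1 + K)⁻¹`, with `K` skew and commuting with `J`. Near `T` the orbit is parametrized by `(1 - K)(1
+ K)⁻¹ T`, with `K` skew and anticommuting with `T`; the inverse is `Z ↦ (T - Z)(T + Z)⁻¹`, and
conjugation by `Q g` carries this to the other points. The inverses are rational on open sets of the
ambient space, so these are slice charts (`SliceChart`) of embedded submanifolds. The quotient maps
bijectively to the orbit, homeomorphically by compactness, and takes its charts from there. The
diffeomorphism is then automatic; what remains is that the projection is a submersion. In charts its
derivative sends an anticommuting `K` to `2K` (`hasDerivAt_orbitInCharts`).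

`GLSym` is open because neither the number of positive nor that of negative eigenvalues drops under
a small perturbation, while their sum is at most `n`. -/

noncomputable section

open Topology Manifold

namespace SymRoots

/-! ### Inverse function theorem and compatible charts -/

section Calculus

variable {E F : Type*} [NormedAddCommGroup E] [NormedSpace ℝ E] [NormedAddCommGroup F]
  [NormedSpace ℝ F]

/-- The analytic inverse function theorem, with a local inverse that is analytic on its whole
domain. -/
theorem exists_openPartialHomeomorph_contDiffOn [CompleteSpace E] {f : E → F} {f' : E ≃L[ℝ] F}
    {a : E} (hf : ContDiffAt ℝ ω f a) (hf' : HasFDerivAt f (f' : E →L[ℝ] F) a) :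
    ∃ e : OpenPartialHomeomorph E F, a ∈ e.source ∧ (∀ x, e x = f x) ∧
      ContDiffOn ℝ ω e e.source ∧ ContDiffOn ℝ ω e.symm e.target := by
  have hω : (ω : WithTop ℕ∞) ≠ 0 := by simp
  -- Analyticity at a point spreads to a neighbourhood, whereas `C^∞` at a point only gives, for
  -- each finite order, a neighbourhood depending on that order. Hence the use of `ω` throughout.
  have hω' : (ω : WithTop ℕ∞) ≠ ∞ := by simp
  refine ⟨(hf.toOpenPartialHomeomorph f hf' hω).restrContDiff ℝ ω hω', ?_, fun x => rfl,
    OpenPartialHomeomorph.contDiffOn_restrContDiff_source _ _ _,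
    OpenPartialHomeomorph.contDiffOn_restrContDiff_target _ _ _⟩
  exact ⟨hf.mem_toOpenPartialHomeomorph_source hf' hω, hf, hf.to_localInverse hf' hω⟩

theorem mem_contDiffGroupoid_of_contDiffOn {e : OpenPartialHomeomorph E E}
    (h : ContDiffOn ℝ ω e e.source) (h' : ContDiffOn ℝ ω e.symm e.target) :
    e ∈ contDiffGroupoid ∞ 𝓘(ℝ, E) := by
  rw [contDiffGroupoid, mem_groupoid_of_pregroupoid]
  simp only [contDiffPregroupoid, modelWithCornersSelf_coe,
    modelWithCornersSelf_coe_symm, Set.range_id, Set.preimage_id, Set.inter_univ,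
    Function.id_comp, Function.comp_id]
  exact ⟨h.of_le le_top, h'.of_le le_top⟩

/-- Lets a chart be straightened by a local diffeomorphism of the model space, as the normal form of
a submersion requires. -/
theorem trans_mem_maximalAtlas {H X : Type*} [TopologicalSpace H] [TopologicalSpace X]
    [ChartedSpace H X] {G : StructureGroupoid H} {φ : OpenPartialHomeomorph X H}
    {e : OpenPartialHomeomorph H H} (hφ : φ ∈ G.maximalAtlas X) (he : e ∈ G) :
    φ ≫ₕ e ∈ G.maximalAtlas X := by
  rw [mem_maximalAtlas_iff] at hφ ⊢
  intro e' he'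
  refine ⟨?_, ?_⟩
  · rw [OpenPartialHomeomorph.trans_symm_eq_symm_trans_symm, OpenPartialHomeomorph.trans_assoc]
    exact G.trans (G.symm he) (hφ e' he').1
  · rw [← OpenPartialHomeomorph.trans_assoc]
    exact G.trans (hφ e' he').2 he

end Calculus

/-! ### Submersions from surjective derivatives -/

section Submersion

variable {E F K X Y : Type*} [NormedAddCommGroup E] [NormedSpace ℝ E] [FiniteDimensional ℝ E]
  [NormedAddCommGroup F] [NormedSpace ℝ F] [FiniteDimensional ℝ F]
  [NormedAddCommGroup K] [NormedSpace ℝ K] [FiniteDimensional ℝ K]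
  [TopologicalSpace X] [ChartedSpace E X] [TopologicalSpace Y] [ChartedSpace F Y]

/-- A map that is analytic in charts, with surjective derivative, is a submersion. -/
theorem isSubmersionAtOfComplement_of_surjective (i : (F × K) ≃L[ℝ] E) {q : X → Y} {x : X}
    (hq : ContinuousAt q x)
    {φ : OpenPartialHomeomorph X E} {ψ : OpenPartialHomeomorph Y F}
    (hφ : φ ∈ IsManifold.maximalAtlas 𝓘(ℝ, E) ∞ X) (hψ : ψ ∈ IsManifold.maximalAtlas 𝓘(ℝ, F) ∞ Y)
    (hx : x ∈ φ.source) (hqx : q x ∈ ψ.source)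
    (hsmooth : ContDiffAt ℝ ω (ψ ∘ q ∘ φ.symm) (φ x))
    (hsurj : Function.Surjective (fderiv ℝ (ψ ∘ q ∘ φ.symm) (φ x))) :
    IsSubmersionAtOfComplement K 𝓘(ℝ, E) 𝓘(ℝ, F) ∞ q x := by
  have : CompleteSpace E := FiniteDimensional.complete ℝ E
  set Ψ := ψ ∘ q ∘ φ.symm with hΨ
  set A := fderiv ℝ Ψ (φ x) with hA
  have hdim : Module.finrank ℝ E = Module.finrank ℝ F + Module.finrank ℝ K := by
    rw [← Module.finrank_prod, i.toLinearEquiv.finrank_eq]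
  have hker : Module.finrank ℝ (A : E →ₗ[ℝ] F).ker = Module.finrank ℝ K := by
    have h1 := LinearMap.finrank_range_add_finrank_ker (A : E →ₗ[ℝ] F)
    rw [LinearMap.range_eq_top.2 hsurj, finrank_top] at h1
    omega
  let L : (A : E →ₗ[ℝ] F).ker ≃ₗ[ℝ] K := LinearEquiv.ofFinrankEq _ _ hker
  obtain ⟨π, hπ⟩ := LinearMap.exists_leftInverse_of_injective (A : E →ₗ[ℝ] F).ker.subtype
    (Submodule.ker_subtype _)
  -- `B` is a coordinate on `ker A`, extended to `E` by a projection `π`. Thus `(A, B)` is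
  -- injective, hence invertible by dimension, and `v ↦ (Ψ v, B v)` is a chart in which `q` is the
  -- first projection.
  let B : E →L[ℝ] K := LinearMap.toContinuousLinearMap (L.toLinearMap ∘ₗ π)
  have hinj : Function.Injective ((A.prod B : E →L[ℝ] F × K) : E →ₗ[ℝ] F × K) := by
    rw [← LinearMap.ker_eq_bot, LinearMap.ker_eq_bot']
    intro v hv
    have h1 : A v = 0 := congrArg Prod.fst hv
    have h2 : L (π v) = 0 := congrArg Prod.snd hv
    have h3 : π v = ⟨v, h1⟩ := LinearMap.congr_fun hπ ⟨v, h1⟩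
    have h4 : π v = 0 := by simpa using h2
    rw [h4] at h3
    exact (congrArg Subtype.val h3).symm
  let D : E ≃L[ℝ] F × K := (LinearEquiv.ofInjectiveOfFinrankEq _ hinj
    (by rw [Module.finrank_prod, hdim])).toContinuousLinearEquiv
  have hD : (D : E →L[ℝ] F × K) = A.prod B := by
    ext v <;> rfl
  let θ : E → F × K := fun v => (Ψ v, B v)
  have hθ : ContDiffAt ℝ ω θ (φ x) := hsmooth.prodMk B.contDiff.contDiffAt
  have hθ' : HasFDerivAt θ (D : E →L[ℝ] F × K) (φ x) := by
    rw [hD]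
    exact (hsmooth.differentiableAt (by simp)).hasFDerivAt.prodMk B.hasFDerivAt
  obtain ⟨e, he, heq, hc, hc'⟩ := exists_openPartialHomeomorph_contDiffOn hθ hθ'
  let e' : OpenPartialHomeomorph E E := e ≫ₕ i.toHomeomorph.toOpenPartialHomeomorph
  have he' : e' ∈ contDiffGroupoid ∞ 𝓘(ℝ, E) := by
    apply mem_contDiffGroupoid_of_contDiffOn
    · exact (i.contDiff.comp_contDiffOn hc).mono (by simp [e'])
    · exact hc'.comp i.symm.contDiff.contDiffOn (by intro y hy; simpa [e'] using hy)
  refine IsSubmersionAtOfComplement.mk_of_continuousAt hq i.symm (φ ≫ₕ e') ψ ?_ hqx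
    (trans_mem_maximalAtlas hφ he') hψ ?_
  · simp [e', hx, he]
  · intro w hw
    have hw' : i.symm w ∈ e.target := by
      simp [e'] at hw
      exact hw.1
    have h1 : θ (e.symm (i.symm w)) = i.symm w := by
      rw [← heq, e.right_inv hw']
    have h2 : Ψ (e.symm (i.symm w)) = (i.symm w).1 := congrArg Prod.fst h1
    simpa [e', hΨ] using h2

end Submersion

/-! ### Embedded submanifolds from slice charts -/

section Slice

variable {E X : Type*} (F : Type*) [NormedAddCommGroup E] [NormedSpace ℝ E]
  [NormedAddCommGroup F] [NormedSpace ℝ F]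

/-- An analytic parametrization `param` of the part of the image of `f` in the open set `domain`,
with an analytic coordinate function `coord` on `domain` that inverts it. -/
structure SliceChart (f : X → E) where
  domain : Set E
  coord : E → F
  param : F → E
  lift : F → X
  isOpen_domain : IsOpen domain
  contDiffOn_coord : ContDiffOn ℝ ω coord domain
  contDiff_param : ContDiff ℝ ω param
  apply_lift : ∀ v, f (lift v) = param v
  param_mem : ∀ v, param v ∈ domain
  coord_param : ∀ v, coord (param v) = v
  param_coord : ∀ x, f x ∈ domain → param (coord (f x)) = f x

namespace SliceChart

variable {F} {f : X → E}

/-- The chain rule for `coord ∘ param = id`: the parametrization is immersive and the coordinate map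
submersive along it. -/
theorem fderiv_coord_comp (c : SliceChart F f) (v : F) :
    (fderiv ℝ c.coord (c.param v)).comp (fderiv ℝ c.param v) = ContinuousLinearMap.id ℝ F := by
  have h1 : HasFDerivAt c.coord (fderiv ℝ c.coord (c.param v)) (c.param v) :=
    ((c.contDiffOn_coord.contDiffAt (c.isOpen_domain.mem_nhds
      (c.param_mem v))).differentiableAt (by simp)).hasFDerivAt
  have h2 : HasFDerivAt c.param (fderiv ℝ c.param v) v :=
    (c.contDiff_param.differentiable (by simp) v).hasFDerivAt
  have h3 : c.coord ∘ c.param = id := funext c.coord_param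
  have h4 := h1.comp v h2
  rw [h3] at h4
  exact h4.unique (hasFDerivAt_id v)

theorem finrank_le [FiniteDimensional ℝ E] (c : SliceChart F f) : Module.finrank ℝ F ≤ Module.finrank ℝ E := by
  have h := c.fderiv_coord_comp 0
  refine LinearMap.finrank_le_finrank_of_injective
    (f := ((fderiv ℝ c.param 0 : F →L[ℝ] E) : F →ₗ[ℝ] E)) ?_
  exact Function.LeftInverse.injective (g := fderiv ℝ c.coord (c.param 0))
    (fun v => by simpa using DFunLike.congr_fun h v)

/-- Transport of a slice chart along a bijection of the source. -/
def comp {X' : Type*} (c : SliceChart F f) (e : X' ≃ X) :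
    SliceChart F (f ∘ e) where
  domain := c.domain
  coord := c.coord
  param := c.param
  lift := e.symm ∘ c.lift
  isOpen_domain := c.isOpen_domain
  contDiffOn_coord := c.contDiffOn_coord
  contDiff_param := c.contDiff_param
  apply_lift v := by simpa using c.apply_lift v
  param_mem := c.param_mem
  coord_param := c.coord_param
  param_coord x hx := c.param_coord (e x) hx

variable [TopologicalSpace X]

/-- The chart of `X` given by a slice chart of an embedding. -/
@[simps]
def toChart (c : SliceChart F f) (hf : IsEmbedding f) : OpenPartialHomeomorph X F where
  toFun x := c.coord (f x)
  invFun := c.lift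
  source := f ⁻¹' c.domain
  target := Set.univ
  map_source' _ _ := Set.mem_univ _
  map_target' v _ := by
    rw [Set.mem_preimage, c.apply_lift]
    exact c.param_mem v
  left_inv' x hx := hf.injective (by rw [c.apply_lift, c.param_coord x hx])
  right_inv' v _ := by rw [c.apply_lift, c.coord_param]
  open_source := c.isOpen_domain.preimage hf.continuous
  open_target := isOpen_univ
  continuousOn_toFun := c.contDiffOn_coord.continuousOn.comp hf.continuous.continuousOn
    (fun _ h => h)
  continuousOn_invFun := by
    rw [← continuousOn_univ.symm, hf.continuous_iff]
    simpa only [Function.comp_def, c.apply_lift] using c.contDiff_param.continuous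

/-- Since `f ∘ lift = param`, a change of charts is the coordinate map of one slice chart after the
parametrization of another, both analytic in the ambient space. -/
theorem trans_mem_contDiffGroupoid (c c' : SliceChart F f) (hf : IsEmbedding f) :
    (c.toChart hf).symm ≫ₕ c'.toChart hf ∈ contDiffGroupoid ∞ 𝓘(ℝ, F) := by
  have key : ∀ c c' : SliceChart F f, ContDiffOn ℝ ω (fun v => c'.coord (f (c.lift v)))
      {v | f (c.lift v) ∈ c'.domain} := by
    intro c c'
    simp only [c.apply_lift]
    exact c'.contDiffOn_coord.comp c.contDiff_param.contDiffOn (fun _ h => h)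
  apply mem_contDiffGroupoid_of_contDiffOn
  · exact (key c c').mono (fun v hv => by simpa using hv)
  · exact (key c' c).mono (fun v hv => by simpa using hv)

/-- The charted space whose atlas consists of the slice charts. -/
abbrev chartedSpace (hf : IsEmbedding f) (h : ∀ x, ∃ c : SliceChart F f, f x ∈ c.domain) :
    ChartedSpace F X where
  atlas := Set.range fun c : SliceChart F f => c.toChart hf
  chartAt x := (h x).choose.toChart hf
  mem_chart_source x := (h x).choose_spec
  chart_mem_atlas _ := ⟨_, rfl⟩

theorem isManifold (hf : IsEmbedding f) (h : ∀ x, ∃ c : SliceChart F f, f x ∈ c.domain) :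
    @IsManifold ℝ _ F _ _ F _ 𝓘(ℝ, F) ∞ X _ (chartedSpace hf h) := by
  let _ := chartedSpace hf h
  have : HasGroupoid X (contDiffGroupoid ∞ 𝓘(ℝ, F)) := by
    refine ⟨?_⟩
    rintro _ _ ⟨c, rfl⟩ ⟨c', rfl⟩
    exact c.trans_mem_contDiffGroupoid c' hf
  exact IsManifold.mk' _ _ _

theorem toChart_mem_maximalAtlas (hf : IsEmbedding f)
    (h : ∀ x, ∃ c : SliceChart F f, f x ∈ c.domain) (c : SliceChart F f) :
    letI := chartedSpace hf h
    c.toChart hf ∈ IsManifold.maximalAtlas 𝓘(ℝ, F) ∞ X := by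
  let _ := chartedSpace hf h
  have := isManifold hf h
  exact IsManifold.subset_maximalAtlas ⟨c, rfl⟩

variable [FiniteDimensional ℝ E] [FiniteDimensional ℝ F]

/-- With `B` an isomorphism of `K` onto the kernel of the derivative of `coord`, the map `(v, w) ↦
param v + B w` is a local diffeomorphism at `(v₀, 0)`. Its inverse straightens the image of `f` to
`w = 0`. -/
theorem isImmersionAtOfComplement {K : Type*} [NormedAddCommGroup K] [NormedSpace ℝ K]
    [FiniteDimensional ℝ K] (hf : IsEmbedding f)
    (h : ∀ x, ∃ c : SliceChart F f, f x ∈ c.domain) (i : (F × K) ≃L[ℝ] E) (x : X) :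
    letI := chartedSpace hf h
    IsImmersionAtOfComplement K 𝓘(ℝ, F) 𝓘(ℝ, E) ∞ f x := by
  let _ := chartedSpace hf h
  have := isManifold hf h
  have : CompleteSpace F := FiniteDimensional.complete ℝ F
  have : CompleteSpace K := FiniteDimensional.complete ℝ K
  obtain ⟨c, hc⟩ := h x
  set v₀ := c.coord (f x) with hv₀
  set A := fderiv ℝ c.param v₀ with hA
  set R := fderiv ℝ c.coord (c.param v₀) with hR
  have hRA : ∀ v, R (A v) = v := fun v => by
    simpa using DFunLike.congr_fun (c.fderiv_coord_comp v₀) v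
  have hdim : Module.finrank ℝ E = Module.finrank ℝ F + Module.finrank ℝ K := by
    rw [← Module.finrank_prod, i.toLinearEquiv.finrank_eq]
  have hker : Module.finrank ℝ K = Module.finrank ℝ (R : E →ₗ[ℝ] F).ker := by
    have h1 := LinearMap.finrank_range_add_finrank_ker (R : E →ₗ[ℝ] F)
    rw [LinearMap.range_eq_top.2 (fun v => ⟨A v, hRA v⟩), finrank_top] at h1
    omega
  let L : K ≃ₗ[ℝ] (R : E →ₗ[ℝ] F).ker := LinearEquiv.ofFinrankEq _ _ hker
  let B : K →L[ℝ] E := LinearMap.toContinuousLinearMap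
    ((R : E →ₗ[ℝ] F).ker.subtype ∘ₗ L.toLinearMap)
  have hRB : ∀ w, R (B w) = 0 := fun w => (L w).2
  have hinj : Function.Injective ((A.coprod B : F × K →L[ℝ] E) : F × K →ₗ[ℝ] E) := by
    rw [← LinearMap.ker_eq_bot, LinearMap.ker_eq_bot']
    rintro ⟨v, w⟩ hv
    have hv' : A v + B w = 0 := by simpa using hv
    have h1 : v = 0 := by
      have := congrArg R hv'
      simpa [hRA, hRB] using this
    have h2 : B w = 0 := by simpa [h1] using hv'
    have h3 : L w = 0 := Subtype.ext h2
    have h4 : w = 0 := by simpa using h3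
    rw [h1, h4]; rfl
  let D : (F × K) ≃L[ℝ] E := (LinearEquiv.ofInjectiveOfFinrankEq _ hinj
    (by rw [Module.finrank_prod, hdim])).toContinuousLinearEquiv
  have hD : (D : F × K →L[ℝ] E) = A.coprod B := by
    ext v <;> rfl
  let θ : F × K → E := fun p => c.param p.1 + B p.2
  have hθ : ContDiffAt ℝ ω θ (v₀, 0) :=
    ((c.contDiff_param.comp contDiff_fst).add (B.contDiff.comp contDiff_snd)).contDiffAt
  have hθ' : HasFDerivAt θ (D : F × K →L[ℝ] E) (v₀, 0) := by
    have h1 : HasFDerivAt c.param A v₀ :=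
      (c.contDiff_param.differentiable (by simp) v₀).hasFDerivAt
    have h2 : HasFDerivAt (fun p : F × K => c.param p.1) (A.comp (ContinuousLinearMap.fst ℝ F K))
        (v₀, 0) := HasFDerivAt.comp (v₀, (0 : K)) h1 hasFDerivAt_fst
    have h3 : HasFDerivAt (fun p : F × K => B p.2) (B.comp (ContinuousLinearMap.snd ℝ F K))
        (v₀, 0) := HasFDerivAt.comp (v₀, (0 : K)) B.hasFDerivAt hasFDerivAt_snd
    convert! h2.add h3 using 1
  obtain ⟨e, he, heq, hec, hec'⟩ := exists_openPartialHomeomorph_contDiffOn hθ hθ'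
  let ψ : OpenPartialHomeomorph E E := e.symm ≫ₕ i.toHomeomorph.toOpenPartialHomeomorph
  have hψ : ψ ∈ contDiffGroupoid ∞ 𝓘(ℝ, E) := by
    apply mem_contDiffGroupoid_of_contDiffOn
    · exact (i.contDiff.comp_contDiffOn hec').mono (by simp [ψ])
    · exact hec.comp i.symm.contDiff.contDiffOn (by intro y hy; simpa [ψ] using hy)
  let s : Set F := (fun v => (v, (0 : K))) ⁻¹' e.source
  have hs : IsOpen s := e.open_source.preimage (by fun_prop)
  -- The slice chart covers all of `F`, but the straightening map exists only near `(v₀, 0)`, so the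
  -- chart has to shrink.
  let t : Set X := (c.toChart hf).source ∩ (c.toChart hf) ⁻¹' s
  have ht : IsOpen t := (c.toChart hf).isOpen_inter_preimage hs
  have hxe : f x = e (v₀, 0) := by
    rw [heq]
    simp [θ, hv₀, c.param_coord x hc]
  refine IsImmersionAtOfComplement.mk_of_continuousAt hf.continuous.continuousAt i
    ((c.toChart hf).restr t) ψ ?_ ?_
    (restr_mem_maximalAtlas _ (toChart_mem_maximalAtlas hf h c) ht)
    (StructureGroupoid.mem_maximalAtlas_of_mem_groupoid _ hψ) ?_
  · rw [OpenPartialHomeomorph.restr_source' _ _ ht]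
    exact ⟨hc, hc, he⟩
  · simpa [ψ, hxe] using e.map_source he
  · intro v hv
    have hv' : c.lift v ∈ t := by
      simpa [ht.interior_eq] using hv
    have hvs : (v, (0 : K)) ∈ e.source := by
      have : c.coord (f (c.lift v)) ∈ s := hv'.2
      rwa [c.apply_lift, c.coord_param] at this
    have h1 : e (v, 0) = c.param v := by
      rw [heq]; simp [θ]
    have h2 : e.symm (c.param v) = (v, 0) := by rw [← h1, e.left_inv hvs]
    simp [ψ, c.apply_lift, h2]

end SliceChart

end Slice

/-- A map covered by slice charts is a smooth embedding of a manifold. -/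
def SliceChart.embeddedStructure {d : ℕ} {X E : Type} [TopologicalSpace X] [Nonempty X]
    [NormedAddCommGroup E] [NormedSpace ℝ E] [FiniteDimensional ℝ E] {f : X → E}
    (hf : IsEmbedding f)
    (h : ∀ x, ∃ c : SliceChart (EuclideanSpace ℝ (Fin d)) f, f x ∈ c.domain) :
    EmbeddedStructure d f where
  charted := SliceChart.chartedSpace hf h
  isManifold := SliceChart.isManifold hf h
  isSmoothEmbedding := by
    let _ := SliceChart.chartedSpace hf h
    refine ⟨?_, hf⟩
    -- One point supplies a slice chart, hence `d ≤ dim E`, so that the truncated subtraction in the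
    -- codimension is a true one.
    obtain ⟨x⟩ := ‹Nonempty X›
    obtain ⟨c, -⟩ := h x
    have hle := c.finrank_le
    let i : (EuclideanSpace ℝ (Fin d) × EuclideanSpace ℝ (Fin (Module.finrank ℝ E - d))) ≃ₗ[ℝ] E :=
      LinearEquiv.ofFinrankEq _ _ (by
        simp only [finrank_euclideanSpace, Fintype.card_fin, Module.finrank_prod] at hle ⊢
        omega)
    exact ⟨_, _, _, fun x => SliceChart.isImmersionAtOfComplement hf h
      i.toContinuousLinearEquiv x⟩

/-- Bijective reparametrization of an embedded manifold gives a diffeomorphic manifold. -/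
theorem areDiffeomorphic_of_homeomorph {k : ℕ} {X Y E : Type} [TopologicalSpace X]
    [TopologicalSpace Y] [NormedAddCommGroup E] [NormedSpace ℝ E] {f : Y → E} (e : X ≃ₜ Y)
    (S : EmbeddedStructure k (f ∘ e)) (S' : EmbeddedStructure k f) :
    AreDiffeomorphic k k S.charted S'.charted := by
  let _ := S.charted
  let _ := S'.charted
  have := S.isManifold
  have := S'.isManifold
  refine ⟨{ toEquiv := e.toEquiv, contMDiff_toFun := ?_, contMDiff_invFun := ?_ }⟩
  -- A continuous map into an embedded manifold is smooth once its composite with the embedding is;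
  -- here that composite is the other embedding.
  · exact (ContMDiff.iff_comp_isImmersion S'.isSmoothEmbedding.isImmersion).2
      ⟨e.continuous, S.isSmoothEmbedding.contMDiff⟩
  · refine (ContMDiff.iff_comp_isImmersion S.isSmoothEmbedding.isImmersion).2
      ⟨e.symm.continuous, ?_⟩
    have : (f ∘ e) ∘ e.symm = f := by ext; simp
    change ContMDiff _ _ _ ((f ∘ e) ∘ e.symm)
    rw [this]
    exact S'.isSmoothEmbedding.contMDiff

/-! ### Analyticity of matrix operations -/

section MatrixCalculus

variable {E : Type*} [NormedAddCommGroup E] [NormedSpace ℝ E] {n : ℕ}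
  {f g : E → Matrix (Fin n) (Fin n) ℝ} {x : E}

theorem contDiffAt_matrix_iff :
    ContDiffAt ℝ ω f x ↔ ∀ i j, ContDiffAt ℝ ω (fun y => f y i j) x := by
  refine contDiffAt_pi.trans (forall_congr' fun i => ?_)
  exact contDiffAt_pi

theorem _root_.ContDiffAt.matrix_mul (hf : ContDiffAt ℝ ω f x) (hg : ContDiffAt ℝ ω g x) :
    ContDiffAt ℝ ω (fun y => f y * g y) x := by
  rw [contDiffAt_matrix_iff] at *
  intro i j
  simp only [Matrix.mul_apply]
  exact ContDiffAt.sum fun k _ => (hf i k).mul (hg k j)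

theorem _root_.ContDiffAt.matrix_transpose (hf : ContDiffAt ℝ ω f x) :
    ContDiffAt ℝ ω (fun y => (f y).transpose) x := by
  rw [contDiffAt_matrix_iff] at *
  exact fun i j => hf j i

theorem _root_.ContDiffAt.matrix_det (hf : ContDiffAt ℝ ω f x) :
    ContDiffAt ℝ ω (fun y => (f y).det) x := by
  rw [contDiffAt_matrix_iff] at hf
  simp only [Matrix.det_apply']
  exact ContDiffAt.sum fun σ _ => contDiffAt_const.mul (contDiffAt_prod fun i _ => hf _ _)

theorem _root_.ContDiffAt.matrix_inv (hf : ContDiffAt ℝ ω f x) (hx : IsUnit (f x)) :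
    ContDiffAt ℝ ω (fun y => (f y)⁻¹) x := by
  have hdet : (f x).det ≠ 0 := ((Matrix.isUnit_iff_isUnit_det _).1 hx).ne_zero
  have hadj : ContDiffAt ℝ ω (fun y => (f y).adjugate) x := by
    rw [contDiffAt_matrix_iff]
    intro i j
    simp only [Matrix.adjugate_apply]
    apply ContDiffAt.matrix_det
    rw [contDiffAt_matrix_iff] at hf ⊢
    intro k l
    by_cases hk : k = j
    · subst hk
      simp only [Matrix.updateRow_self]
      exact contDiffAt_const
    · simp only [Matrix.updateRow_ne hk]
      exact hf k l
  simp only [Matrix.inv_def, Ring.inverse_eq_inv']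
  exact (hf.matrix_det.inv hdet).smul hadj

end MatrixCalculus

theorem isOpen_setOf_isUnit_matrix {E : Type*} [TopologicalSpace E] {n : ℕ}
    {f : E → Matrix (Fin n) (Fin n) ℝ} (hf : Continuous f) : IsOpen {y | IsUnit (f y)} := by
  simp only [Matrix.isUnit_iff_isUnit_det, isUnit_iff_ne_zero]
  exact isOpen_ne_fun (Continuous.matrix_det hf) continuous_const

/-! ### Algebra of the Cayley transform -/

section Cayley

variable {n : ℕ} {A J K T W X Y Z : Matrix (Fin n) (Fin n) ℝ}

theorem mul_inv_of_isUnit (hA : IsUnit A) : A * A⁻¹ = 1 :=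
  A.mul_nonsing_inv ((Matrix.isUnit_iff_isUnit_det A).1 hA)

theorem inv_mul_of_isUnit (hA : IsUnit A) : A⁻¹ * A = 1 :=
  A.nonsing_inv_mul ((Matrix.isUnit_iff_isUnit_det A).1 hA)

theorem mul_inv_eq_iff (hA : IsUnit A) : X * A⁻¹ = Y ↔ X = Y * A := by
  constructor
  · rintro rfl
    rw [mul_assoc, inv_mul_of_isUnit hA, mul_one]
  · rintro rfl
    rw [mul_assoc, mul_inv_of_isUnit hA, mul_one]

theorem inv_mul_eq_iff (hA : IsUnit A) : A⁻¹ * X = Y ↔ X = A * Y := by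
  constructor
  · rintro rfl
    rw [← mul_assoc, mul_inv_of_isUnit hA, one_mul]
  · rintro rfl
    rw [← mul_assoc, inv_mul_of_isUnit hA, one_mul]

theorem commute_inv (hA : IsUnit A) (h : Commute J A) : Commute J A⁻¹ := by
  rw [Commute, SemiconjBy, eq_comm, inv_mul_eq_iff hA, ← mul_assoc, eq_comm, mul_inv_eq_iff hA, h.eq]

/-- The generalised Cayley transform. -/
def cayley (T Z : Matrix (Fin n) (Fin n) ℝ) : Matrix (Fin n) (Fin n) ℝ := (T - Z) * (T + Z)⁻¹

/-- For skew `K` the product `(1 - K)(1 + K) = 1 + KᵀK` is positive definite. The parametrizations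
are therefore defined on whole linear spaces. -/
theorem isUnit_one_add_of_skew (hK : K.transpose = -K) : IsUnit (1 + K) := by
  have h : ((1 : Matrix (Fin n) (Fin n) ℝ) + K.transpose * K).PosDef :=
    Matrix.PosDef.one.add_posSemidef (by simpa using Matrix.posSemidef_conjTranspose_mul_self K)
  have h2 : 1 + K.transpose * K = (1 - K) * (1 + K) := by
    rw [hK]; noncomm_ring
  rw [h2] at h
  have h3 := h.isUnit
  rw [Matrix.isUnit_iff_isUnit_det, Matrix.det_mul] at h3
  rw [Matrix.isUnit_iff_isUnit_det]
  exact isUnit_of_mul_isUnit_right h3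

theorem isUnit_one_sub_of_skew (hK : K.transpose = -K) : IsUnit (1 - K) := by
  rw [sub_eq_add_neg]
  exact isUnit_one_add_of_skew (by rw [Matrix.transpose_neg, hK])

theorem transpose_cayley_of_skew (hK : K.transpose = -K) :
    (cayley 1 K).transpose = (1 - K)⁻¹ * (1 + K) := by
  rw [cayley, Matrix.transpose_mul, Matrix.transpose_nonsing_inv]
  simp [hK, sub_eq_add_neg]

theorem cayley_mem_orthogonalGroup (hK : K.transpose = -K) :
    cayley 1 K ∈ Matrix.orthogonalGroup (Fin n) ℝ := by
  rw [Matrix.mem_orthogonalGroup_iff']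
  change (cayley 1 K).transpose * _ = 1
  rw [transpose_cayley_of_skew hK, mul_assoc, inv_mul_eq_iff (isUnit_one_sub_of_skew hK), cayley,
    ← mul_assoc, mul_inv_eq_iff (isUnit_one_add_of_skew hK)]
  noncomm_ring

theorem commute_cayley (hA : IsUnit (1 + K)) (h : Commute J K) : Commute J (cayley 1 K) :=
  ((Commute.one_right J).sub_right h).mul_right
    (commute_inv hA ((Commute.one_right J).add_right h))

/-- Moving `T` across `K` changes the sign of `K`, and for skew `K` that sign change transposes the
Cayley transform. This makes `cayley 1 K * T` symmetric when `T` is. -/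
theorem cayley_mul_eq_of_anticommute (hK : K.transpose = -K) (hKT : K * T = -(T * K)) :
    cayley 1 K * T = T * (cayley 1 K).transpose := by
  have h : (1 + K)⁻¹ * T = T * (1 - K)⁻¹ := by
    rw [inv_mul_eq_iff (isUnit_one_add_of_skew hK), ← mul_assoc, eq_comm,
      mul_inv_eq_iff (isUnit_one_sub_of_skew hK), add_mul, mul_sub, hKT]
    noncomm_ring
  have h' : (1 - K) * T = T * (1 + K) := by
    rw [sub_mul, mul_add, hKT]
    noncomm_ring
  have h3 : (1 - K)⁻¹ * (1 + K) = (1 + K) * (1 - K)⁻¹ := by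
    rw [inv_mul_eq_iff (isUnit_one_sub_of_skew hK), ← mul_assoc, eq_comm,
      mul_inv_eq_iff (isUnit_one_sub_of_skew hK)]
    noncomm_ring
  rw [transpose_cayley_of_skew hK, cayley, mul_assoc, h, ← mul_assoc, h', h3, mul_assoc]

theorem one_add_cayley (h : IsUnit (T + Z)) : 1 + cayley T Z = (2 : ℝ) • (T * (T + Z)⁻¹) := by
  rw [cayley, ← smul_mul_assoc, eq_comm, mul_inv_eq_iff h, add_mul, mul_assoc,
    inv_mul_of_isUnit h, two_smul]
  noncomm_ring

theorem one_sub_cayley (h : IsUnit (T + Z)) : 1 - cayley T Z = (2 : ℝ) • (Z * (T + Z)⁻¹) := by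
  rw [cayley, ← smul_mul_assoc, eq_comm, mul_inv_eq_iff h, sub_mul, mul_assoc,
    inv_mul_of_isUnit h, two_smul]
  noncomm_ring

theorem isUnit_add_cayley_mul (h : IsUnit (1 + K)) (hT : IsUnit T) :
    IsUnit (T + cayley 1 K * T) := by
  have : T + cayley 1 K * T = (2 : ℝ) • (1 + K)⁻¹ * T := by
    rw [← one_mul (1 + K)⁻¹, ← one_add_cayley h, add_mul, one_mul]
  rw [this]
  refine IsUnit.mul ?_ hT
  rw [Matrix.isUnit_iff_isUnit_det, Matrix.det_smul]
  refine IsUnit.mul (by simp) ?_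
  exact (Matrix.isUnit_nonsing_inv_det_iff).2 ((Matrix.isUnit_iff_isUnit_det _).1 h)

theorem cayley_cayley_mul (h : IsUnit (1 + K)) (hT : IsUnit T) :
    cayley T (cayley 1 K * T) = K := by
  rw [cayley, mul_inv_eq_iff (isUnit_add_cayley_mul h hT)]
  have h1 : T - cayley 1 K * T = (1 - cayley 1 K) * T := by rw [sub_mul, one_mul]
  have h2 : T + cayley 1 K * T = (1 + cayley 1 K) * T := by rw [add_mul, one_mul]
  rw [h1, h2, one_sub_cayley h, one_add_cayley h]
  simp [mul_assoc]

theorem cayley_one_cayley_mul (h : IsUnit (T + Z)) (hT : IsUnit T)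
    (hK : IsUnit (1 + cayley T Z)) : cayley 1 (cayley T Z) * T = Z := by
  have h1 : cayley 1 (cayley T Z) = Z * T⁻¹ := by
    conv_lhs => rw [cayley]
    rw [mul_inv_eq_iff hK, one_sub_cayley h, one_add_cayley h, mul_smul_comm, mul_assoc,
      ← mul_assoc T⁻¹, inv_mul_of_isUnit hT, one_mul]
  rw [h1, mul_assoc, inv_mul_of_isUnit hT, mul_one]

/-- Clearing inverses, skewness becomes `(T - Z)(T + Z) + (T + Z)(T - Z) = 2(T² - Z²) = 0`. -/
theorem transpose_cayley_of_symm (hT : T.IsSymm) (hZ : Z.IsSymm) (hZT : Z * Z = T * T)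
    (h : IsUnit (T + Z)) : (cayley T Z).transpose = -cayley T Z := by
  rw [cayley, Matrix.transpose_mul, Matrix.transpose_nonsing_inv, Matrix.transpose_add,
    Matrix.transpose_sub, hT.eq, hZ.eq, inv_mul_eq_iff h, ← neg_mul, ← mul_assoc, eq_comm,
    mul_inv_eq_iff h]
  have : (T - Z) * (T + Z) - (T + Z) * (-(T - Z)) = (2 : ℝ) • (T * T - Z * Z) := by
    rw [two_smul]; noncomm_ring
  rw [hZT, sub_self, smul_zero, sub_eq_zero] at this
  exact this.symm

/-- Equal squares give `T(T + Z) = (T + Z)Z` and `(T - Z)Z = -T(T - Z)`; combine the two. -/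
theorem cayley_mul_anticommute (hZT : Z * Z = T * T) (h : IsUnit (T + Z)) :
    cayley T Z * T = -(T * cayley T Z) := by
  have h1 : (T + Z)⁻¹ * T = Z * (T + Z)⁻¹ := by
    rw [inv_mul_eq_iff h, ← mul_assoc, eq_comm, mul_inv_eq_iff h, add_mul, mul_add, hZT, add_comm]
  rw [cayley, mul_assoc, h1, ← mul_assoc, ← mul_assoc, ← neg_mul, sub_mul, mul_sub, hZT]
  congr 1
  abel

theorem transpose_cayley_of_orthogonal (hZ : Z ∈ Matrix.orthogonalGroup (Fin n) ℝ)
    (h : IsUnit (1 + Z)) : (cayley 1 Z).transpose = -cayley 1 Z := by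
  have h' : IsUnit (1 + Z.transpose) := by
    rw [Matrix.isUnit_iff_isUnit_det] at h ⊢
    rwa [← Matrix.det_transpose, Matrix.transpose_add, Matrix.transpose_transpose,
      Matrix.transpose_one]
  have hZ' : Z.transpose * Z = 1 := (Matrix.mem_orthogonalGroup_iff' _ _).1 hZ
  rw [cayley, Matrix.transpose_mul, Matrix.transpose_nonsing_inv, Matrix.transpose_add,
    Matrix.transpose_sub, Matrix.transpose_one, inv_mul_eq_iff h', ← neg_mul, ← mul_assoc, eq_comm,
    mul_inv_eq_iff h]
  have h1 : (1 + Z.transpose) * (-(1 - Z)) = Z.transpose * Z - 1 + Z - Z.transpose := by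
    noncomm_ring
  have h2 : (1 - Z.transpose) * (1 + Z) = 1 - Z.transpose * Z + Z - Z.transpose := by
    noncomm_ring
  rw [h1, h2, hZ']

end Cayley

/-- Coordinates of a subspace that extend to the ambient space. -/
theorem exists_coordinates {E : Type*} [NormedAddCommGroup E] [NormedSpace ℝ E]
    [FiniteDimensional ℝ E] (V : Submodule ℝ E) :
    ∃ (a : EuclideanSpace ℝ (Fin (Module.finrank ℝ V)) →L[ℝ] E)
      (b : E →L[ℝ] EuclideanSpace ℝ (Fin (Module.finrank ℝ V))),
      (∀ v, a v ∈ V) ∧ (∀ v, b (a v) = v) ∧ ∀ x ∈ V, a (b x) = x := by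
  let e : EuclideanSpace ℝ (Fin (Module.finrank ℝ V)) ≃ₗ[ℝ] V :=
    LinearEquiv.ofFinrankEq _ _ (by simp)
  obtain ⟨π, hπ⟩ := LinearMap.exists_leftInverse_of_injective V.subtype (Submodule.ker_subtype _)
  have hπ' : ∀ x : V, π x = x := fun x => LinearMap.congr_fun hπ x
  refine ⟨LinearMap.toContinuousLinearMap (V.subtype ∘ₗ e.toLinearMap),
    LinearMap.toContinuousLinearMap (e.symm.toLinearMap ∘ₗ π), fun v => (e v).2, fun v => ?_,
    fun x hx => ?_⟩
  · simp [hπ']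
  · simp [hπ' ⟨x, hx⟩]

/-! ### The group `C_J ∩ O_n`: compactness and charts -/

section Orthogonal

variable {n : ℕ} {J : Matrix (Fin n) (Fin n) ℝ}

theorem transpose_mul_orthIncl (X : orthCentralizer J) :
    (orthIncl J X).transpose * orthIncl J X = 1 :=
  (Matrix.mem_orthogonalGroup_iff' _ _).1 X.1.2

theorem orthIncl_mul_transpose (X : orthCentralizer J) :
    orthIncl J X * (orthIncl J X).transpose = 1 :=
  (Matrix.mem_orthogonalGroup_iff _ _).1 X.1.2

theorem commute_orthIncl (X : orthCentralizer J) : Commute J (orthIncl J X) := X.2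

theorem isEmbedding_orthIncl : IsEmbedding (orthIncl J) :=
  IsEmbedding.subtypeVal.comp IsEmbedding.subtypeVal

theorem range_orthIncl :
    Set.range (orthIncl J) = {A | A.transpose * A = 1 ∧ J * A = A * J} := by
  ext A
  constructor
  · rintro ⟨X, rfl⟩
    exact ⟨transpose_mul_orthIncl X, commute_orthIncl X⟩
  · rintro ⟨h, h'⟩
    exact ⟨⟨⟨A, (Matrix.mem_orthogonalGroup_iff' _ _).2 h⟩, h'⟩, rfl⟩

instance compactSpace_orthCentralizer : CompactSpace (orthCentralizer J) := by
  rw [← isCompact_univ_iff, isEmbedding_orthIncl.isCompact_iff, Set.image_univ]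
  apply Metric.isCompact_of_isClosed_isBounded
  · rw [range_orthIncl]
    apply IsClosed.inter
    · exact isClosed_eq (by fun_prop) continuous_const
    · exact isClosed_eq (by fun_prop) (by fun_prop)
  · refine (Metric.isBounded_closedBall (x := 0) (r := 1)).subset ?_
    rintro _ ⟨X, rfl⟩
    rw [mem_closedBall_zero_iff, Matrix.norm_le_iff zero_le_one]
    exact fun i j => entry_norm_bound_of_unitary X.1.2 i j

/-- The Lie algebra of `C_J ∩ O_n`. -/
def skewCommutant (J : Matrix (Fin n) (Fin n) ℝ) : Submodule ℝ (Matrix (Fin n) (Fin n) ℝ) where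
  carrier := {K | K.transpose = -K ∧ Commute J K}
  add_mem' ha hb := ⟨by rw [Matrix.transpose_add, ha.1, hb.1, neg_add], ha.2.add_right hb.2⟩
  zero_mem' := ⟨by simp, Commute.zero_right J⟩
  smul_mem' c _ ha := ⟨by rw [Matrix.transpose_smul, ha.1, smul_neg], ha.2.smul_right c⟩

/-- The skew symmetric matrices that anticommute with `T`. -/
def skewAnticommutant (T : Matrix (Fin n) (Fin n) ℝ) :
    Submodule ℝ (Matrix (Fin n) (Fin n) ℝ) where
  carrier := {K | K.transpose = -K ∧ K * T = -(T * K)}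
  add_mem' ha hb := ⟨by rw [Matrix.transpose_add, ha.1, hb.1, neg_add],
    by rw [add_mul, mul_add, ha.2, hb.2, neg_add]⟩
  zero_mem' := ⟨by simp, by simp⟩
  smul_mem' c _ ha := ⟨by rw [Matrix.transpose_smul, ha.1, smul_neg],
    by rw [smul_mul_assoc, mul_smul_comm, ha.2, smul_neg]⟩

/-- Crossing `T` twice restores the sign. Tangent directions of the orbit thus lift to the Lie
algebra of the group, which gives both the dimension inequality and the surjectivity needed for the
submersion. -/
theorem skewAnticommutant_le (T : Matrix (Fin n) (Fin n) ℝ) :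
    skewAnticommutant T ≤ skewCommutant (T * T) := by
  rintro K ⟨h, h'⟩
  refine ⟨h, ?_⟩
  rw [Commute, SemiconjBy, ← mul_assoc, h', neg_mul, mul_assoc T K T, h', mul_neg, neg_neg,
    mul_assoc]

/-- The element of `C_J ∩ O_n` with a given Cayley transform. -/
def cayleyOrth (K : Matrix (Fin n) (Fin n) ℝ) (hK : K ∈ skewCommutant J) : orthCentralizer J :=
  ⟨⟨cayley 1 K, cayley_mem_orthogonalGroup hK.1⟩,
    commute_cayley (isUnit_one_add_of_skew hK.1) hK.2⟩

theorem contDiffAt_cayley {E : Type*} [NormedAddCommGroup E] [NormedSpace ℝ E]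
    {f : E → Matrix (Fin n) (Fin n) ℝ} {x : E} {T : Matrix (Fin n) (Fin n) ℝ}
    (hf : ContDiffAt ℝ ω f x) (h : IsUnit (T + f x)) :
    ContDiffAt ℝ ω (fun y => cayley T (f y)) x :=
  (contDiffAt_const.sub hf).matrix_mul ((contDiffAt_const.add hf).matrix_inv h)

variable {F : Type*} [NormedAddCommGroup F] [NormedSpace ℝ F]

/-- The slice chart of `C_J ∩ O_n` at `g` given by the Cayley transform. -/
def groupSlice (a : F →L[ℝ] Matrix (Fin n) (Fin n) ℝ) (b : Matrix (Fin n) (Fin n) ℝ →L[ℝ] F)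
    (ha : ∀ v, a v ∈ skewCommutant J) (hba : ∀ v, b (a v) = v)
    (hab : ∀ K ∈ skewCommutant J, a (b K) = K) (g : orthCentralizer J) :
    SliceChart F (orthIncl J) where
  domain := {Y | IsUnit (1 + (orthIncl J g).transpose * Y)}
  coord Y := b (cayley 1 ((orthIncl J g).transpose * Y))
  param v := orthIncl J g * cayley 1 (a v)
  lift v := g * cayleyOrth (a v) (ha v)
  isOpen_domain := isOpen_setOf_isUnit_matrix (by fun_prop)
  contDiffOn_coord Y hY := by
    refine ContDiffAt.contDiffWithinAt (b.contDiff.contDiffAt.comp Y ?_)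
    exact contDiffAt_cayley (contDiffAt_const.matrix_mul contDiffAt_id) hY
  contDiff_param := by
    rw [contDiff_iff_contDiffAt]
    exact fun v => contDiffAt_const.matrix_mul
      (contDiffAt_cayley a.contDiff.contDiffAt (isUnit_one_add_of_skew (ha v).1))
  apply_lift v := rfl
  param_mem v := by
    change IsUnit (1 + _ * (_ * _))
    rw [← mul_assoc, transpose_mul_orthIncl, one_mul]
    simpa using isUnit_add_cayley_mul (isUnit_one_add_of_skew (ha v).1) isUnit_one
  coord_param v := by
    rw [← mul_assoc, transpose_mul_orthIncl, one_mul]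
    conv_rhs => rw [← hba v]
    simpa using congrArg b (cayley_cayley_mul (isUnit_one_add_of_skew (ha v).1) isUnit_one)
  param_coord X hX := by
    have hX' : IsUnit (1 + orthIncl J (g⁻¹ * X)) := hX
    have hskew := transpose_cayley_of_orthogonal (g⁻¹ * X).1.2 hX'
    have hmem : cayley 1 (orthIncl J (g⁻¹ * X)) ∈ skewCommutant J :=
      ⟨hskew, commute_cayley hX' (commute_orthIncl _)⟩
    change _ * cayley 1 (a (b (cayley 1 (orthIncl J (g⁻¹ * X))))) = _
    have h := cayley_one_cayley_mul hX' isUnit_one (isUnit_one_add_of_skew hskew)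
    rw [mul_one] at h
    rw [hab _ hmem, h]
    change orthIncl J (g * (g⁻¹ * X)) = _
    rw [mul_inv_cancel_left]

end Orthogonal

/-! ### The orbit map, its fibres and the quotient -/

section Orbit

variable {n : ℕ} {Q T J : Matrix (Fin n) (Fin n) ℝ}

theorem isSymm_conj (hT : T.IsSymm) (P : Matrix (Fin n) (Fin n) ℝ) :
    (P * T * P.transpose).IsSymm := by
  rw [Matrix.IsSymm, Matrix.transpose_mul, Matrix.transpose_mul, Matrix.transpose_transpose,
    hT.eq, mul_assoc]

/-- The orbit map `X ↦ Q X T Xᵀ Qᵀ` on `C_J ∩ O_n`. -/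
def orbitMap (J Q : Matrix (Fin n) (Fin n) ℝ) (hT : T.IsSymm) (X : orthCentralizer J) : Sym n :=
  ⟨(Q * orthIncl J X) * T * (Q * orthIncl J X).transpose, isSymm_conj hT _⟩

theorem continuous_orbitMap (hT : T.IsSymm) : Continuous (orbitMap J Q hT) := by
  have : Continuous (orthIncl J) := isEmbedding_orthIncl.continuous
  exact Continuous.subtype_mk (by fun_prop) _

theorem conj_cancel {P : Matrix (Fin n) (Fin n) ℝ} (hP : P.transpose * P = 1)
    (Z : Matrix (Fin n) (Fin n) ℝ) : P.transpose * (P * Z * P.transpose) * P = Z := by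
  have : P.transpose * (P * Z * P.transpose) * P =
      (P.transpose * P) * Z * (P.transpose * P) := by noncomm_ring
  rw [this, hP, one_mul, mul_one]

theorem conj_inj {P : Matrix (Fin n) (Fin n) ℝ} (hP : P.transpose * P = 1)
    {Y Z : Matrix (Fin n) (Fin n) ℝ} (h : P * Y * P.transpose = P * Z * P.transpose) : Y = Z := by
  rw [← conj_cancel hP Y, h, conj_cancel hP]

theorem orbitMap_eq_iff (hT : T.IsSymm) (hQ : Q.transpose * Q = 1) (X Y : orthCentralizer J) :
    orbitMap J Q hT X = orbitMap J Q hT Y ↔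
      X⁻¹ * Y ∈ (orthCentralizer T).subgroupOf (orthCentralizer J) := by
  have hX := transpose_mul_orthIncl X
  have hX' := orthIncl_mul_transpose X
  have hY := transpose_mul_orthIncl Y
  have hY' := orthIncl_mul_transpose Y
  rw [Subgroup.mem_subgroupOf]
  change _ ↔ Commute T ((orthIncl J X).transpose * orthIncl J Y)
  have h1 : orbitMap J Q hT X = orbitMap J Q hT Y ↔
      orthIncl J X * T * (orthIncl J X).transpose =
        orthIncl J Y * T * (orthIncl J Y).transpose := by
    rw [← Subtype.coe_inj]
    have : ∀ Z, ((orbitMap J Q hT Z : Sym n) : Matrix (Fin n) (Fin n) ℝ) =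
        Q * (orthIncl J Z * T * (orthIncl J Z).transpose) * Q.transpose := by
      intro Z
      simp only [orbitMap, Matrix.transpose_mul]
      noncomm_ring
    rw [this, this]
    exact ⟨fun h => conj_inj hQ h, fun h => by rw [h]⟩
  rw [h1, Commute, SemiconjBy]
  generalize orthIncl J X = A at *
  generalize orthIncl J Y = B at *
  constructor
  · intro h
    calc T * (A.transpose * B) = (A.transpose * A) * T * A.transpose * B := by
          rw [hX]; noncomm_ring
      _ = A.transpose * (A * T * A.transpose) * B := by noncomm_ring
      _ = A.transpose * B * T * (B.transpose * B) := by rw [h]; noncomm_ring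
      _ = A.transpose * B * T := by rw [hY, mul_one]
  · intro h
    calc A * T * A.transpose = A * T * A.transpose * (B * B.transpose) := by rw [hY', mul_one]
      _ = A * (T * (A.transpose * B)) * B.transpose := by noncomm_ring
      _ = (A * A.transpose) * B * T * B.transpose := by rw [h]; noncomm_ring
      _ = B * T * B.transpose := by rw [hX', one_mul]

/-- The orbit map factors through a homeomorphism from the quotient by the stabilizer. -/
theorem exists_homeomorph_orbit (hT : T.IsSymm) (hQ : Q.transpose * Q = 1)
    {S : Set (Sym n)} (hS : S = Set.range (orbitMap J Q hT)) :
    ∃ e : (orthCentralizer J ⧸ (orthCentralizer T).subgroupOf (orthCentralizer J)) ≃ₜ S,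
      ∀ X : orthCentralizer J, ((e (QuotientGroup.mk X) : S) : Sym n) = orbitMap J Q hT X := by
  subst hS
  let φ : (orthCentralizer J ⧸ (orthCentralizer T).subgroupOf (orthCentralizer J)) →
      Set.range (orbitMap J Q hT) :=
    Quotient.lift (fun X => ⟨orbitMap J Q hT X, X, rfl⟩) (fun X Y h => Subtype.ext
      ((orbitMap_eq_iff hT hQ X Y).2 (QuotientGroup.leftRel_apply.1 h)))
  have hφ : Continuous φ :=
    Continuous.quotient_lift (Continuous.subtype_mk (continuous_orbitMap hT) _) _
  have hinj : Function.Injective φ := by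
    intro x y
    induction x using QuotientGroup.induction_on with | _ X
    induction y using QuotientGroup.induction_on with | _ Y
    intro h
    exact QuotientGroup.eq.2 ((orbitMap_eq_iff hT hQ X Y).1 (congrArg Subtype.val h))
  have hsurj : Function.Surjective φ := by
    rintro ⟨_, X, rfl⟩
    exact ⟨QuotientGroup.mk X, rfl⟩
  exact ⟨hφ.homeoOfEquivCompactToT2 (f := Equiv.ofBijective φ ⟨hinj, hsurj⟩), fun X => rfl⟩

end Orbit

/-! ### Charts of the orbit and the orbit map in charts -/

section Orbit

variable {n : ℕ} {Q T J : Matrix (Fin n) (Fin n) ℝ}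

/-- Real symmetric matrices with the same characteristic polynomial are orthogonally similar. -/
theorem exists_orthogonal_conj_of_charpoly_eq {A B : Matrix (Fin n) (Fin n) ℝ} (hA : A.IsSymm)
    (hB : B.IsSymm) (h : A.charpoly = B.charpoly) :
    ∃ g ∈ Matrix.orthogonalGroup (Fin n) ℝ, B = g * A * g.transpose := by
  have hA' : A.IsHermitian := by simpa [Matrix.IsHermitian] using hA.eq
  have hB' : B.IsHermitian := by simpa [Matrix.IsHermitian] using hB.eq
  have he := (Matrix.IsHermitian.eigenvalues_eq_eigenvalues_iff hA' hB').2 h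
  have h1 := hA'.spectral_theorem
  have h2 := hB'.spectral_theorem
  rw [Unitary.conjStarAlgAut_apply] at h1 h2
  rw [← he] at h2
  set D := Matrix.diagonal (RCLike.ofReal (K := ℝ) ∘ hA'.eigenvalues)
  set U := hA'.eigenvectorUnitary
  set V := hB'.eigenvectorUnitary
  refine ⟨(V * star U : Matrix.unitaryGroup (Fin n) ℝ), (V * star U).2, ?_⟩
  have hU : star (U : Matrix (Fin n) (Fin n) ℝ) * U = 1 := Unitary.coe_star_mul_self U
  change B = _ * A * star ((V * star U : Matrix.unitaryGroup (Fin n) ℝ) : Matrix _ _ ℝ)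
  rw [Submonoid.coe_mul, Unitary.coe_star, star_mul, star_star]
  conv_rhs => rw [h1]
  calc B = V * 1 * D * 1 * star (V : Matrix (Fin n) (Fin n) ℝ) := by
        rw [mul_one, mul_one]; exact h2
    _ = _ := by rw [← hU]; noncomm_ring

/-- Two roots of the same matrix with invertible sum are similar. -/
theorem charpoly_eq_of_isUnit_add {Z : Matrix (Fin n) (Fin n) ℝ} (hZ : Z * Z = T * T)
    (h : IsUnit (T + Z)) : Z.charpoly = T.charpoly := by
  have h1 : (T + Z) * T = Z * (T + Z) := by rw [add_mul, mul_add, hZ, add_comm]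
  have h2 : Z = (T + Z) * T * (T + Z)⁻¹ := by rw [eq_comm, mul_inv_eq_iff h, h1]
  rw [h2, mul_assoc, Matrix.charpoly_mul_comm, mul_assoc, inv_mul_of_isUnit h, mul_one]

/-- Any orthogonal `g` with `Z = g T gᵀ` satisfies `g T² gᵀ = Z² = T²`, so it lies in the
centralizer automatically. -/
theorem exists_orthCentralizer_conj {Z : Matrix (Fin n) (Fin n) ℝ} (hT : T.IsSymm) (hZ : Z.IsSymm)
    (hZT : Z * Z = T * T) (h : Z.charpoly = T.charpoly) :
    ∃ X : orthCentralizer (T * T), Z = orthIncl _ X * T * (orthIncl _ X).transpose := by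
  obtain ⟨g, hg, rfl⟩ := exists_orthogonal_conj_of_charpoly_eq hT hZ h.symm
  have hg1 : g.transpose * g = 1 := (Matrix.mem_orthogonalGroup_iff' _ _).1 hg
  refine ⟨⟨⟨g, hg⟩, ?_⟩, rfl⟩
  change T * T * g = g * (T * T)
  calc T * T * g = g * T * g.transpose * (g * T * g.transpose) * g := by rw [hZT]
    _ = g * T * (g.transpose * g) * T * (g.transpose * g) := by noncomm_ring
    _ = g * (T * T) := by rw [hg1]; noncomm_ring

/-- A linear retraction onto `Sym n`: composing with it expresses the orbit parametrization as an
analytic map into the subspace. -/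
theorem exists_symmProj (n : ℕ) :
    ∃ σ : Matrix (Fin n) (Fin n) ℝ →L[ℝ] Sym n, ∀ A : Sym n, σ A = A := by
  obtain ⟨σ, hσ⟩ := LinearMap.exists_leftInverse_of_injective (Sym n).subtype
    (Submodule.ker_subtype _)
  exact ⟨LinearMap.toContinuousLinearMap σ, fun A => LinearMap.congr_fun hσ A⟩

theorem cayley_mul_isSymm {K : Matrix (Fin n) (Fin n) ℝ} (hT : T.IsSymm)
    (hK : K ∈ skewAnticommutant T) : (cayley 1 K * T).IsSymm := by
  rw [Matrix.IsSymm, Matrix.transpose_mul, hT.eq, ← cayley_mul_eq_of_anticommute hK.1 hK.2]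

theorem cayley_mul_sq {K : Matrix (Fin n) (Fin n) ℝ} (hK : K ∈ skewAnticommutant T) :
    cayley 1 K * T * (cayley 1 K * T) = T * T := by
  have h1 := commute_cayley (isUnit_one_add_of_skew hK.1) (skewAnticommutant_le T hK).2
  have h2 : cayley 1 K * (cayley 1 K).transpose = 1 :=
    (Matrix.mem_orthogonalGroup_iff _ _).1 (cayley_mem_orthogonalGroup hK.1)
  conv_lhs => enter [2]; rw [cayley_mul_eq_of_anticommute hK.1 hK.2]
  calc _ = cayley 1 K * (T * T) * (cayley 1 K).transpose := by noncomm_ring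
    _ = T * T := by rw [← h1.eq, mul_assoc, h2, mul_one]

theorem coe_orbitMap_mul (hT : T.IsSymm) (g X : orthCentralizer J) :
    ((orbitMap J Q hT (g * X) : Sym n) : Matrix (Fin n) (Fin n) ℝ) =
      Q * orthIncl J g * (orthIncl J X * T * (orthIncl J X).transpose) *
        (Q * orthIncl J g).transpose := by
  change (Q * (orthIncl J g * orthIncl J X)) * T * (Q * (orthIncl J g * orthIncl J X)).transpose = _
  simp only [Matrix.transpose_mul]
  noncomm_ring

theorem transpose_mul_self_mul_orthIncl (hQ : Q.transpose * Q = 1) (g : orthCentralizer J) :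
    (Q * orthIncl J g).transpose * (Q * orthIncl J g) = 1 := by
  rw [Matrix.transpose_mul, mul_assoc, ← mul_assoc Q.transpose, hQ, one_mul,
    transpose_mul_orthIncl]

variable {F : Type*} [NormedAddCommGroup F] [NormedSpace ℝ F]

/-- The slice chart of the orbit at `P T Pᵀ`, `P = Q g`, given by `Z ↦ (T - Z) (T + Z)⁻¹`. -/
def orbitSlice (hT : T.IsSymm) (hTu : IsUnit T) (hQ : Q.transpose * Q = 1)
    {σ : Matrix (Fin n) (Fin n) ℝ →L[ℝ] Sym n} (hσ : ∀ A : Sym n, σ A = A)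
    (a : F →L[ℝ] Matrix (Fin n) (Fin n) ℝ) (b : Matrix (Fin n) (Fin n) ℝ →L[ℝ] F)
    (ha : ∀ v, a v ∈ skewAnticommutant T) (hba : ∀ v, b (a v) = v)
    (hab : ∀ K ∈ skewAnticommutant T, a (b K) = K)
    {S : Set (Sym n)} (hS : S = Set.range (orbitMap (T * T) Q hT)) (g : orthCentralizer (T * T)) :
    SliceChart F (Subtype.val : S → Sym n) where
  domain := {Y | IsUnit (T + (Q * orthIncl _ g).transpose * Y * (Q * orthIncl _ g))}
  coord Y := b (cayley T ((Q * orthIncl _ g).transpose * Y * (Q * orthIncl _ g)))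
  param v := σ ((Q * orthIncl _ g) * (cayley 1 (a v) * T) * (Q * orthIncl _ g).transpose)
  lift v := ⟨⟨(Q * orthIncl _ g) * (cayley 1 (a v) * T) * (Q * orthIncl _ g).transpose,
    isSymm_conj (cayley_mul_isSymm hT (ha v)) _⟩, by
      have hu := isUnit_one_add_of_skew (ha v).1
      have hZ := cayley_mul_sq (ha v)
      -- The parametrized `Z` has `Z² = T²` and `T + Z` invertible, so it is similar to `T`; being
      -- symmetric, it lies in the orbit.
      obtain ⟨X, hX⟩ := exists_orthCentralizer_conj hT (cayley_mul_isSymm hT (ha v)) hZ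
        (charpoly_eq_of_isUnit_add hZ (isUnit_add_cayley_mul hu hTu))
      rw [hS]
      refine ⟨g * X, Subtype.ext ?_⟩
      rw [coe_orbitMap_mul, ← hX]⟩
  isOpen_domain := isOpen_setOf_isUnit_matrix (by fun_prop)
  contDiffOn_coord Y hY := by
    refine ContDiffAt.contDiffWithinAt (b.contDiff.contDiffAt.comp Y ?_)
    exact contDiffAt_cayley ((contDiffAt_const.matrix_mul
      (Sym n).subtypeL.contDiff.contDiffAt).matrix_mul contDiffAt_const) hY
  contDiff_param := by
    rw [contDiff_iff_contDiffAt]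
    intro v
    refine σ.contDiff.contDiffAt.comp v ?_
    exact (contDiffAt_const.matrix_mul ((contDiffAt_cayley a.contDiff.contDiffAt
      (isUnit_one_add_of_skew (ha v).1)).matrix_mul contDiffAt_const)).matrix_mul contDiffAt_const
  apply_lift v := (hσ ⟨_, isSymm_conj (cayley_mul_isSymm hT (ha v)) _⟩).symm
  param_mem v := by
    have h := hσ ⟨_, isSymm_conj (cayley_mul_isSymm hT (ha v)) (Q * orthIncl _ g)⟩
    rw [h]
    change IsUnit (T + _ * (_ * _ * _) * _)
    rw [conj_cancel (transpose_mul_self_mul_orthIncl hQ g)]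
    exact isUnit_add_cayley_mul (isUnit_one_add_of_skew (ha v).1) hTu
  coord_param v := by
    have h := hσ ⟨_, isSymm_conj (cayley_mul_isSymm hT (ha v)) (Q * orthIncl _ g)⟩
    rw [h]
    change b (cayley T (_ * (_ * _ * _) * _)) = _
    rw [conj_cancel (transpose_mul_self_mul_orthIncl hQ g),
      cayley_cayley_mul (isUnit_one_add_of_skew (ha v).1) hTu, hba]
  param_coord x hx := by
    subst hS
    obtain ⟨_, X, rfl⟩ := x
    have hP := transpose_mul_self_mul_orthIncl hQ g
    -- Writing `X = g (g⁻¹ X)` and undoing the conjugation by `Q g` reduces to the chart centred at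
    -- `T`.
    have hX := coe_orbitMap_mul (Q := Q) hT g (g⁻¹ * X)
    rw [mul_inv_cancel_left] at hX
    set Z := orthIncl _ (g⁻¹ * X) * T * (orthIncl _ (g⁻¹ * X)).transpose with hZ
    have hZs : Z.IsSymm := isSymm_conj hT _
    have hZT : Z * Z = T * T := by
      have h1 := transpose_mul_orthIncl (g⁻¹ * X)
      have h2 := orthIncl_mul_transpose (g⁻¹ * X)
      have h3 := commute_orthIncl (g⁻¹ * X)
      rw [hZ]
      generalize orthIncl _ (g⁻¹ * X) = A at *
      calc _ = A * T * (A.transpose * A) * T * A.transpose := by noncomm_ring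
        _ = A * (T * T) * A.transpose := by rw [h1]; noncomm_ring
        _ = T * T := by rw [← h3.eq, mul_assoc, h2, mul_one]
    have hx' : IsUnit (T + (Q * orthIncl _ g).transpose *
      (orbitMap (T * T) Q hT X : Sym n) * (Q * orthIncl _ g)) := hx
    rw [hX, conj_cancel hP] at hx'
    have hskew := transpose_cayley_of_symm hT hZs hZT hx'
    have hK : cayley T Z ∈ skewAnticommutant T := ⟨hskew, cayley_mul_anticommute hZT hx'⟩
    change σ (_ * (cayley 1 (a (b (cayley T (_ * (orbitMap (T * T) Q hT X : Sym n) * _)))) * _) * _)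
      = orbitMap (T * T) Q hT X
    rw [hX, conj_cancel hP, hab _ hK,
      cayley_one_cayley_mul hx' hTu (isUnit_one_add_of_skew hskew), ← hX, hσ]

/-- The orbit map in the charts `groupSlice` and `orbitSlice`. -/
def orbitInCharts (T K : Matrix (Fin n) (Fin n) ℝ) : Matrix (Fin n) (Fin n) ℝ :=
  cayley T (cayley 1 K * T * (cayley 1 K).transpose)

theorem cayley_one_zero : cayley 1 (0 : Matrix (Fin n) (Fin n) ℝ) = 1 := by
  simp [cayley]

theorem isUnit_add_self (hTu : IsUnit T) : IsUnit (T + T) := by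
  rw [← two_smul ℝ T, Matrix.isUnit_iff_isUnit_det, Matrix.det_smul]
  exact IsUnit.mul (by simp) ((Matrix.isUnit_iff_isUnit_det _).1 hTu)

theorem contDiffAt_orbitInCharts {E : Type*} [NormedAddCommGroup E] [NormedSpace ℝ E]
    {f : E → Matrix (Fin n) (Fin n) ℝ} {x : E} (hTu : IsUnit T) (hf : ContDiffAt ℝ ω f x)
    (hx : f x = 0) : ContDiffAt ℝ ω (fun y => orbitInCharts T (f y)) x := by
  have h : ContDiffAt ℝ ω (fun y => cayley 1 (f y)) x := contDiffAt_cayley hf (by simp [hx])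
  refine contDiffAt_cayley ((h.matrix_mul contDiffAt_const).matrix_mul h.matrix_transpose) ?_
  simpa [hx, cayley_one_zero] using isUnit_add_self hTu

/-- With `C` the Cayley transform of `tK`, anticommutation gives `C T Cᵀ = C² T`. The numerator `T -
C² T = (1 - C)(1 + C) T` is then `4t K (1 + tK)⁻² T`, so the curve is `t • h t` and its derivative
at `0` is `h 0 = 4 K T (2T)⁻¹ = 2K`. -/
theorem hasDerivAt_orbitInCharts {K : Matrix (Fin n) (Fin n) ℝ} (hTu : IsUnit T)
    (hK : K ∈ skewAnticommutant T) :
    HasDerivAt (fun t : ℝ => orbitInCharts T (t • K)) ((2 : ℝ) • K) 0 := by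
  let h : ℝ → Matrix (Fin n) (Fin n) ℝ := fun t =>
    (4 : ℝ) • (K * (1 + t • K)⁻¹ * (1 + t • K)⁻¹ * T) *
      (T + cayley 1 (t • K) * T * (cayley 1 (t • K)).transpose)⁻¹
  have hcd : ContDiffAt ℝ ω h 0 := by
    have h1 : ContDiffAt ℝ ω (fun t : ℝ => t • K) 0 := contDiffAt_id.smul contDiffAt_const
    have h2 : ContDiffAt ℝ ω (fun t : ℝ => (1 + t • K)⁻¹) 0 :=
      (contDiffAt_const.add h1).matrix_inv (by simp)
    have h3 : ContDiffAt ℝ ω (fun t : ℝ => cayley 1 (t • K)) 0 := contDiffAt_cayley h1 (by simp)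
    refine ContDiffAt.matrix_mul (contDiffAt_const.fun_smul (((contDiffAt_const.matrix_mul
      h2).matrix_mul h2).matrix_mul contDiffAt_const)) ?_
    refine ContDiffAt.matrix_inv (contDiffAt_const.add
      ((h3.matrix_mul contDiffAt_const).matrix_mul h3.matrix_transpose)) ?_
    simpa [cayley_one_zero] using isUnit_add_self hTu
  have h0 : h 0 = (2 : ℝ) • K := by
    simp only [h, zero_smul, add_zero, inv_one, mul_one, cayley_one_zero, Matrix.transpose_one,
      one_mul]
    rw [mul_inv_eq_iff (isUnit_add_self hTu), smul_mul_assoc, mul_add, ← two_smul ℝ (K * T),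
      smul_smul]
    norm_num
  have heq : (fun t : ℝ => orbitInCharts T (t • K)) = fun t => t • h t := by
    funext t
    have hmem := (skewAnticommutant T).smul_mem t hK
    have hu := isUnit_one_add_of_skew hmem.1
    have h1 : T - cayley 1 (t • K) * T * (cayley 1 (t • K)).transpose =
        t • (4 : ℝ) • (K * (1 + t • K)⁻¹ * (1 + t • K)⁻¹ * T) := by
      rw [mul_assoc, ← cayley_mul_eq_of_anticommute hmem.1 hmem.2]
      have h2 : T - cayley 1 (t • K) * (cayley 1 (t • K) * T) =
        (1 - cayley 1 (t • K)) * (1 + cayley 1 (t • K)) * T := by noncomm_ring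
      rw [h2, one_sub_cayley hu, one_add_cayley hu, one_mul]
      simp only [smul_mul_assoc, mul_smul_comm, smul_smul]
      congr 1
      ring
    rw [orbitInCharts, cayley, h1, smul_mul_assoc]
  rw [heq]
  refine ((hasDerivAt_id (0 : ℝ)).smul
    (hcd.differentiableAt (by simp)).hasDerivAt).congr_deriv ?_
  simp [h0]

end Orbit

/-! ### The homogeneous space and the submersion onto it -/

/-- The orbit of `T` under `C_{T²} ∩ O_n` is an embedded submanifold, diffeomorphic to the
homogeneous space. -/
theorem exists_homogeneousStructure_areDiffeomorphic {n : ℕ} {Q T J : Matrix (Fin n) (Fin n) ℝ}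
    (hT : T.IsSymm) (hTu : IsUnit T) (hQ : Q.transpose * Q = 1) (hJ : T * T = J)
    {S : Set (Sym n)} (hS : S = Set.range (orbitMap J Q hT)) :
    ∃ (d k : ℕ) (G : EmbeddedStructure d (orthIncl J))
      (GH : HomogeneousStructure d k G.charted
        ((orthCentralizer T).subgroupOf (orthCentralizer J)))
      (S' : EmbeddedStructure k (Subtype.val : S → Sym n)),
      AreDiffeomorphic k k GH.charted S'.charted := by
  subst hJ
  obtain ⟨a, b, ha, hba, hab⟩ := exists_coordinates (skewCommutant (T * T))
  obtain ⟨a', b', ha', hba', hab'⟩ := exists_coordinates (skewAnticommutant T)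
  obtain ⟨σ, hσ⟩ := exists_symmProj n
  obtain ⟨e, he⟩ := exists_homeomorph_orbit hT hQ hS
  let cG := groupSlice a b ha hba hab
  let cS := orbitSlice hT hTu hQ hσ a' b' ha' hba' hab' hS
  have hG : ∀ g, orthIncl (T * T) g ∈ (cG g).domain := fun g => by
    change IsUnit (1 + _)
    rw [transpose_mul_orthIncl]
    exact isUnit_add_self isUnit_one
  have hSd : ∀ g : orthCentralizer (T * T), orbitMap (T * T) Q hT g ∈ (cS g).domain := fun g => by
    change IsUnit (T + _ * (_ * _ * _) * _)
    rw [conj_cancel (transpose_mul_self_mul_orthIncl hQ g)]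
    exact isUnit_add_self hTu
  have hval : IsEmbedding (Subtype.val : S → Sym n) := IsEmbedding.subtypeVal
  have hcov : ∀ x : S, ∃ c : SliceChart (EuclideanSpace ℝ
      (Fin (Module.finrank ℝ (skewAnticommutant T)))) (Subtype.val : S → Sym n), x.1 ∈ c.domain := by
    intro x
    obtain ⟨g, hg⟩ : x.1 ∈ Set.range (orbitMap (T * T) Q hT) := hS ▸ x.2
    exact ⟨cS g, hg ▸ hSd g⟩
  have hval' : IsEmbedding ((Subtype.val : S → Sym n) ∘ e) := hval.comp e.isEmbedding
  have hcov' : ∀ x, ∃ c : SliceChart (EuclideanSpace ℝ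
      (Fin (Module.finrank ℝ (skewAnticommutant T)))) ((Subtype.val : S → Sym n) ∘ e),
      ((Subtype.val : S → Sym n) ∘ e) x ∈ c.domain := by
    intro x
    obtain ⟨c, hc⟩ := hcov (e x)
    exact ⟨c.comp e.toEquiv, hc⟩
  have : Nonempty S := ⟨e (QuotientGroup.mk 1)⟩
  let EG := SliceChart.embeddedStructure isEmbedding_orthIncl (fun g => ⟨cG g, hG g⟩)
  -- The quotient is embedded by `e` followed by the inclusion of the orbit, so `e` itself becomes
  -- the diffeomorphism.
  let EH := SliceChart.embeddedStructure hval' hcov'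
  let ES := SliceChart.embeddedStructure hval hcov
  refine ⟨_, _, EG, ⟨EH.charted, EH.isManifold, ?_⟩, ES, areDiffeomorphic_of_homeomorph e EH ES⟩
  let _ := EG.charted
  let _ := EH.charted
  have hle : Module.finrank ℝ (skewAnticommutant T) ≤ Module.finrank ℝ (skewCommutant (T * T)) :=
    Submodule.finrank_mono (skewAnticommutant_le T)
  let i : (EuclideanSpace ℝ (Fin (Module.finrank ℝ (skewAnticommutant T))) ×
      EuclideanSpace ℝ (Fin (Module.finrank ℝ (skewCommutant (T * T)) -
        Module.finrank ℝ (skewAnticommutant T)))) ≃ₗ[ℝ]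
      EuclideanSpace ℝ (Fin (Module.finrank ℝ (skewCommutant (T * T)))) :=
    LinearEquiv.ofFinrankEq _ _ (by
      simp only [finrank_euclideanSpace, Fintype.card_fin, Module.finrank_prod]
      omega)
  refine ⟨EuclideanSpace ℝ (Fin (Module.finrank ℝ (skewCommutant (T * T)) -
    Module.finrank ℝ (skewAnticommutant T))), inferInstance, inferInstance, fun g => ?_⟩
  let ψ := ((cS g).comp e.toEquiv).toChart hval'
  let φ := (cG g).toChart isEmbedding_orthIncl
  have hφg : φ g = 0 := by
    change b (cayley 1 ((orthIncl _ g).transpose * orthIncl _ g)) = 0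
    rw [transpose_mul_orthIncl, cayley, sub_self, zero_mul, map_zero]
  -- Both charts are centred by left translation with `g`, so by equivariance the local expression
  -- depends on neither `g` nor `Q`.
  have hΨ : ψ ∘ (QuotientGroup.mk : orthCentralizer (T * T) → _) ∘ φ.symm =
      fun v => b' (orbitInCharts T (a v)) := by
    funext v
    change (cS g).coord (e (QuotientGroup.mk (g * cayleyOrth (a v) (ha v)))) = _
    rw [he]
    change b' (cayley T (_ * (orbitMap (T * T) Q hT _ : Sym n) * _)) = _
    rw [coe_orbitMap_mul, conj_cancel (transpose_mul_self_mul_orthIncl hQ g)]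
    rfl
  have hsm : ContDiffAt ℝ ω (fun v => b' (orbitInCharts T (a v))) 0 :=
    b'.contDiff.contDiffAt.comp _
      (contDiffAt_orbitInCharts hTu a.contDiff.contDiffAt (map_zero a))
  refine isSubmersionAtOfComplement_of_surjective i.toContinuousLinearEquiv (φ := φ) (ψ := ψ)
    QuotientGroup.continuous_mk.continuousAt
    (SliceChart.toChart_mem_maximalAtlas isEmbedding_orthIncl _ _)
    (SliceChart.toChart_mem_maximalAtlas hval' hcov' _) (hG g) ?_ ?_ ?_
  · change ((e (QuotientGroup.mk g) : S) : Sym n) ∈ (cS g).domain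
    rw [he]
    exact hSd g
  · rw [hΨ, hφg]
    exact hsm
  · rw [hΨ, hφg]
    intro w
    -- The factor `1/2` cancels the `2` in the derivative `2K`, so this direction is sent exactly to
    -- `w`.
    have hK := (skewAnticommutant T).smul_mem (1 / 2 : ℝ) (ha' w)
    have hK' := skewAnticommutant_le T hK
    refine ⟨b ((1 / 2 : ℝ) • a' w), ?_⟩
    have hline : HasDerivAt (fun t : ℝ => t • b ((1 / 2 : ℝ) • a' w))
        (b ((1 / 2 : ℝ) • a' w)) 0 := by
      simpa using (hasDerivAt_id (0 : ℝ)).smul_const (b ((1 / 2 : ℝ) • a' w))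
    have hd : HasFDerivAt (fun v => b' (orbitInCharts T (a v)))
        (fderiv ℝ (fun v => b' (orbitInCharts T (a v))) 0)
        ((fun t : ℝ => t • b ((1 / 2 : ℝ) • a' w)) 0) := by
      simpa using (hsm.differentiableAt (by simp)).hasFDerivAt
    have h1 := hd.comp_hasDerivAt 0 hline
    have h2 := b'.hasFDerivAt.comp_hasDerivAt (0 : ℝ) (hasDerivAt_orbitInCharts hTu hK)
    have h3 : (fun v => b' (orbitInCharts T (a v))) ∘
        (fun t : ℝ => t • b ((1 / 2 : ℝ) • a' w)) =
        b' ∘ fun t : ℝ => orbitInCharts T (t • (1 / 2 : ℝ) • a' w) := by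
      funext t
      simp only [Function.comp_apply, map_smul a, hab _ hK']
    rw [h3] at h1
    rw [h1.unique h2, smul_smul]
    norm_num [hba']

/-! ### Semicontinuity of the signature -/

section Signature

variable {n : ℕ} {A : Matrix (Fin n) (Fin n) ℝ}

theorem card_filter_roots_charpoly (hA : A.IsHermitian) (p : ℝ → Prop) [DecidablePred p] :
    (A.charpoly.roots.filter p).card = Fintype.card {i // p (hA.eigenvalues i)} := by
  rw [hA.roots_charpoly_eq_eigenvalues, Multiset.filter_map, Multiset.card_map,
    Fintype.card_subtype]
  rfl

theorem dotProduct_mulVec_eq_sum_eigenvalues (hA : A.IsHermitian) (y : Fin n → ℝ) :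
    y ⬝ᵥ A.mulVec y = ∑ i, hA.eigenvalues i *
      ((hA.eigenvectorUnitary : Matrix (Fin n) (Fin n) ℝ).transpose.mulVec y i) ^ 2 := by
  set U := (hA.eigenvectorUnitary : Matrix (Fin n) (Fin n) ℝ) with hU
  have h : A = U * Matrix.diagonal hA.eigenvalues * U.transpose := by
    have := hA.spectral_theorem
    rw [Unitary.conjStarAlgAut_apply] at this
    exact this
  conv_lhs => rw [h]
  rw [← Matrix.mulVec_mulVec, ← Matrix.mulVec_mulVec, Matrix.dotProduct_mulVec,
    ← Matrix.mulVec_transpose, dotProduct]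
  refine Finset.sum_congr rfl fun i _ => ?_
  rw [Matrix.mulVec_diagonal]
  ring

/-- A subspace on which the form is definite of sign `s` bounds the number of eigenvalues of that
sign from below. -/
theorem card_le_card_eigenvalues (hA : A.IsHermitian) {ι : Type*} [Fintype ι] (s : ℝ)
    (L : (ι → ℝ) →ₗ[ℝ] (Fin n → ℝ)) (h : ∀ x, x ≠ 0 → 0 < s * (L x ⬝ᵥ A.mulVec (L x))) :
    Fintype.card ι ≤ Fintype.card {i // 0 < s * hA.eigenvalues i} := by
  let U := (hA.eigenvectorUnitary : Matrix (Fin n) (Fin n) ℝ)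
  let f : (ι → ℝ) →ₗ[ℝ] ({i // 0 < s * hA.eigenvalues i} → ℝ) :=
    LinearMap.funLeft ℝ ℝ Subtype.val ∘ₗ Matrix.mulVecLin U.transpose ∘ₗ L
  have hf : Function.Injective f := by
    rw [← LinearMap.ker_eq_bot, LinearMap.ker_eq_bot']
    intro x hx
    by_contra hne
    have h1 := h x hne
    rw [dotProduct_mulVec_eq_sum_eigenvalues hA, Finset.mul_sum] at h1
    refine absurd h1 (not_lt.2 (Finset.sum_nonpos fun i _ => ?_))
    by_cases hi : 0 < s * hA.eigenvalues i
    · have h2 : U.transpose.mulVec (L x) i = 0 := congrFun hx ⟨i, hi⟩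
      rw [h2]
      simp
    · rw [← mul_assoc]
      exact mul_nonpos_of_nonpos_of_nonneg (not_lt.1 hi) (sq_nonneg _)
  simpa using LinearMap.finrank_le_finrank_of_injective hf

/-- On the span of the eigenvectors whose eigenvalues have the sign of `s`, the form of `A` is
definite. Compactness of the unit sphere keeps it definite for nearby `B`, and
`card_le_card_eigenvalues` then counts eigenvalues of `B`. -/
theorem eventually_card_eigenvalues_le (hA : A.IsHermitian) (s : ℝ) :
    ∀ᶠ B in 𝓝 A, ∀ hB : B.IsHermitian, Fintype.card {i // 0 < s * hA.eigenvalues i} ≤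
      Fintype.card {i // 0 < s * hB.eigenvalues i} := by
  let ι := {i // 0 < s * hA.eigenvalues i}
  let U := (hA.eigenvectorUnitary : Matrix (Fin n) (Fin n) ℝ)
  let E : (ι → ℝ) →ₗ[ℝ] (Fin n → ℝ) := Function.ExtendByZero.linearMap ℝ Subtype.val
  let L : (ι → ℝ) →ₗ[ℝ] (Fin n → ℝ) := Matrix.mulVecLin U ∘ₗ E
  have hUU : U.transpose * U = 1 := Unitary.coe_star_mul_self hA.eigenvectorUnitary
  have hpos : ∀ x : ι → ℝ, x ≠ 0 → 0 < s * (L x ⬝ᵥ A.mulVec (L x)) := by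
    intro x hx
    have hLx : U.transpose.mulVec (L x) = E x := by
      change U.transpose.mulVec (U.mulVec (E x)) = E x
      rw [Matrix.mulVec_mulVec, hUU, Matrix.one_mulVec]
    rw [dotProduct_mulVec_eq_sum_eigenvalues hA, Finset.mul_sum]
    change 0 < ∑ i, s * (_ * (U.transpose.mulVec (L x) i) ^ 2)
    rw [hLx]
    have hE : ∀ i : ι, E x i = x i := fun i =>
      Subtype.val_injective.extend_apply x (0 : Fin n → ℝ) i
    have hE' : ∀ i, ¬ 0 < s * hA.eigenvalues i → E x i = 0 := fun i hi =>
      Function.extend_apply' (f := (Subtype.val : ι → Fin n)) x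
        (0 : Fin n → ℝ) i
        (by rintro ⟨j, rfl⟩; exact hi j.2)
    obtain ⟨j, hj⟩ := Function.ne_iff.1 hx
    refine Finset.sum_pos' (fun i _ => ?_) ⟨j, Finset.mem_univ _, ?_⟩
    · rw [← mul_assoc]
      by_cases hi : 0 < s * hA.eigenvalues i
      · exact mul_nonneg hi.le (sq_nonneg _)
      · simp [hE' i hi]
    · rw [← mul_assoc, hE]
      exact mul_pos j.2 (sq_pos_of_ne_zero hj)
  have hcont : Continuous fun z : Matrix (Fin n) (Fin n) ℝ × (ι → ℝ) =>
      s * (L z.2 ⬝ᵥ z.1.mulVec (L z.2)) := by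
    have hL : Continuous L := LinearMap.continuous_of_finiteDimensional L
    exact continuous_const.mul (Continuous.dotProduct (hL.comp continuous_snd)
      (Continuous.matrix_mulVec continuous_fst (hL.comp continuous_snd)))
  have hev := (isCompact_sphere (0 : ι → ℝ) 1).eventually_forall_of_forall_eventually (x₀ := A)
    (P := fun B x => 0 < s * (L x ⬝ᵥ B.mulVec (L x))) (fun x hx =>
      hcont.continuousAt.eventually (lt_mem_nhds (hpos x (by
        rintro rfl
        simp at hx))))
  filter_upwards [hev] with B hB hBh
  refine card_le_card_eigenvalues hBh s L fun x hx => ?_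
  have hx' : 0 < ‖x‖ := norm_pos_iff.2 hx
  -- Compactness controls unit vectors only; homogeneity of degree two gives the rest.
  have h1 := hB (‖x‖⁻¹ • x) (by simp [norm_smul, hx'.ne'])
  have h2 : s * (L (‖x‖⁻¹ • x) ⬝ᵥ B.mulVec (L (‖x‖⁻¹ • x))) =
      ‖x‖⁻¹ * ‖x‖⁻¹ * (s * (L x ⬝ᵥ B.mulVec (L x))) := by
    rw [map_smul, Matrix.mulVec_smul, smul_dotProduct, dotProduct_smul]
    simp only [smul_eq_mul]
    ring
  rw [h2] at h1
  exact pos_of_mul_pos_right h1 (by positivity)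

theorem isOpen_inSym_GLSym (n q : ℕ) : IsOpen (inSym (GLSym n q)) := by
  rw [isOpen_iff_mem_nhds]
  rintro ⟨A, hAs⟩ ⟨hA, hAu, hp, hn⟩
  have hAh : A.IsHermitian := by simpa [Matrix.IsHermitian] using hA.eq
  have hcard : ∀ {B : Matrix (Fin n) (Fin n) ℝ} (hB : B.IsHermitian),
      (B.charpoly.roots.filter (fun x => 0 < x)).card =
        Fintype.card {i // 0 < (1 : ℝ) * hB.eigenvalues i} ∧
      (B.charpoly.roots.filter (fun x => x < 0)).card =
        Fintype.card {i // 0 < (-1 : ℝ) * hB.eigenvalues i} := by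
    intro B hB
    rw [card_filter_roots_charpoly hB, card_filter_roots_charpoly hB]
    simp
  have hsum : ∀ {B : Matrix (Fin n) (Fin n) ℝ} (hB : B.IsHermitian),
      Fintype.card {i // 0 < (1 : ℝ) * hB.eigenvalues i} +
        Fintype.card {i // 0 < (-1 : ℝ) * hB.eigenvalues i} ≤ n := by
    intro B hB
    rw [Fintype.card_subtype, Fintype.card_subtype, ← Finset.card_union_of_disjoint]
    · exact (Finset.card_le_univ _).trans (by simp)
    · rw [Finset.disjoint_filter]
      intro i _ h1 h2
      linarith
  have hunit : ∀ᶠ B : Sym n in 𝓝 ⟨A, hAs⟩, IsUnit (B : Matrix (Fin n) (Fin n) ℝ) :=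
    (isOpen_setOf_isUnit_matrix continuous_subtype_val).mem_nhds hAu
  have hval : Filter.Tendsto (Subtype.val : Sym n → Matrix (Fin n) (Fin n) ℝ) (𝓝 ⟨A, hAs⟩) (𝓝 A) :=
    continuous_subtype_val.continuousAt
  filter_upwards [hunit, hval.eventually (eventually_card_eigenvalues_le hAh 1),
    hval.eventually (eventually_card_eigenvalues_le hAh (-1))] with B hBu h1 h2
  have hBs : (B : Matrix (Fin n) (Fin n) ℝ).IsSymm := B.2
  have hBh : (B : Matrix (Fin n) (Fin n) ℝ).IsHermitian := by
    simpa [Matrix.IsHermitian] using hBs.eq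
  have h3 := h1 hBh
  have h4 := h2 hBh
  have h5 := hsum hBh
  -- The bound for `A` forces `q ≤ n`, so `n - q` is not truncated; for `B` two lower bounds adding
  -- up to `n` must then be equalities.
  have h6 := hsum hAh
  rw [(hcard hAh).1] at hp
  rw [(hcard hAh).2] at hn
  refine ⟨hBs, hBu, ?_, ?_⟩
  · rw [(hcard hBh).1]
    omega
  · rw [(hcard hBh).2]
    omega

end Signature

/-! ### Symmetric orthogonal matrices of given signature -/

section Signs

variable {m : ℕ}

theorem roots_charpoly_diagonal {ι : Type*} [Fintype ι] [DecidableEq ι] (d : ι → ℝ) :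
    (Matrix.diagonal d).charpoly.roots = Finset.univ.val.map d := by
  rw [Matrix.charpoly_diagonal]
  exact Polynomial.roots_multiset_prod_X_sub_C (Finset.univ.val.map d) ▸ by
    rw [Multiset.map_map]; rfl

/-- Having `n` real roots, here `m`, makes both monic polynomials split, so the roots determine
them. -/
theorem charpoly_eq_of_roots_eq {A B : Matrix (Fin m) (Fin m) ℝ}
    (hA : Multiset.card A.charpoly.roots = m) (h : B.charpoly.roots = A.charpoly.roots) :
    B.charpoly = A.charpoly := by
  have key : ∀ C : Matrix (Fin m) (Fin m) ℝ, Multiset.card C.charpoly.roots = m →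
      (C.charpoly.roots.map fun a => Polynomial.X - Polynomial.C a).prod = C.charpoly := by
    intro C hC
    exact Polynomial.prod_multiset_X_sub_C_of_monic_of_roots_card_eq C.charpoly_monic
      (by rw [hC, Matrix.charpoly_natDegree_eq_dim, Fintype.card_fin])
  rw [← key A hA, ← key B (by rw [h, hA]), h]

/-- The matrix `I_u ⊕ (-I_{m-u})`. -/
def signMatrix (m u : ℕ) : Matrix (Fin m) (Fin m) ℝ :=
  Matrix.diagonal (fun a : Fin m => if (a : ℕ) < u then (1 : ℝ) else -1)

theorem signMatrix_isSymm (m u : ℕ) : (signMatrix m u).IsSymm := Matrix.isSymm_diagonal _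

theorem signMatrix_mul_self (m u : ℕ) : signMatrix m u * signMatrix m u = 1 := by
  rw [signMatrix, Matrix.diagonal_mul_diagonal, ← Matrix.diagonal_one]
  congr 1
  ext a
  split_ifs <;> simp

theorem card_filter_lt {u : ℕ} (hu : u ≤ m) :
    (Finset.univ.filter fun a : Fin m => (a : ℕ) < u).card = u := by
  rw [Fin.card_filter_val_lt, min_eq_right hu]

theorem card_filter_not_lt {u : ℕ} (hu : u ≤ m) :
    (Finset.univ.filter fun a : Fin m => ¬ (a : ℕ) < u).card = m - u := by
  have := Finset.card_filter_add_card_filter_not (s := (Finset.univ : Finset (Fin m)))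
    (fun a => (a : ℕ) < u)
  rw [card_filter_lt hu, Finset.card_univ, Fintype.card_fin] at this
  omega

theorem conj_signMatrix_mem {u : ℕ} (hu : u ≤ m) {g : Matrix (Fin m) (Fin m) ℝ}
    (hg : g ∈ Matrix.orthogonalGroup (Fin m) ℝ) :
    g * signMatrix m u * g.transpose ∈ O m ∩ GLSym m u := by
  have hg1 : g.transpose * g = 1 := (Matrix.mem_orthogonalGroup_iff' _ _).1 hg
  have hg2 : g * g.transpose = 1 := (Matrix.mem_orthogonalGroup_iff _ _).1 hg
  have hs : (g * signMatrix m u * g.transpose).IsSymm := isSymm_conj (signMatrix_isSymm m u) g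
  have hsq : g * signMatrix m u * g.transpose * (g * signMatrix m u * g.transpose) = 1 := by
    calc _ = g * signMatrix m u * (g.transpose * g) * signMatrix m u * g.transpose := by
          noncomm_ring
      _ = g * (signMatrix m u * signMatrix m u) * g.transpose := by rw [hg1]; noncomm_ring
      _ = 1 := by rw [signMatrix_mul_self, mul_one, hg2]
  have hroots : (g * signMatrix m u * g.transpose).charpoly.roots = Finset.univ.val.map
      (fun a : Fin m => if (a : ℕ) < u then (1 : ℝ) else -1) := by
    rw [Matrix.charpoly_mul_comm, ← mul_assoc, hg1, one_mul, signMatrix, roots_charpoly_diagonal]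
  refine ⟨(Matrix.mem_orthogonalGroup_iff' _ _).2 ?_, hs, ?_, ?_, ?_⟩
  · rw [hs.eq, hsq]
  · exact IsUnit.of_mul_eq_one _ hsq
  · rw [hroots, Multiset.filter_map, Multiset.card_map]
    refine Eq.trans ?_ (card_filter_lt hu)
    change (Finset.univ.filter _).card = _
    congr 1
    ext a
    simp only [Finset.mem_filter, Function.comp_apply]
    split_ifs with h <;> simp [h]
  · rw [hroots, Multiset.filter_map, Multiset.card_map]
    refine Eq.trans ?_ (card_filter_not_lt hu)
    change (Finset.univ.filter _).card = _
    congr 1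
    ext a
    simp only [Finset.mem_filter, Function.comp_apply]
    split_ifs with h <;> simp [h]

/-- A symmetric orthogonal matrix squares to `1`, so its eigenvalues are `±1` and the signature
fixes their multiplicities. -/
theorem roots_charpoly_of_mem {u : ℕ} {R : Matrix (Fin m) (Fin m) ℝ}
    (hR : R ∈ O m ∩ GLSym m u) :
    R.charpoly.roots = Multiset.replicate u 1 + Multiset.replicate (m - u) (-1) := by
  obtain ⟨hO, hs, -, hp, hn⟩ := hR
  have hsq : R * R = 1 := by
    have := (Matrix.mem_orthogonalGroup_iff' _ _).1 hO
    rwa [hs.eq] at this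
  have hR' : R.IsHermitian := by simpa [Matrix.IsHermitian] using hs.eq
  have hroot : ∀ x ∈ R.charpoly.roots, x = 1 ∨ x = -1 := by
    intro x hx
    rw [hR'.roots_charpoly_eq_eigenvalues, Multiset.mem_map] at hx
    obtain ⟨i, -, rfl⟩ := hx
    have h1 := hR'.mulVec_eigenvectorBasis i
    have h2 := congrArg R.mulVec h1
    rw [Matrix.mulVec_mulVec, hsq, Matrix.one_mulVec, Matrix.mulVec_smul, h1, smul_smul] at h2
    have hne : ((hR'.eigenvectorBasis i : EuclideanSpace ℝ (Fin m)) : Fin m → ℝ) ≠ 0 := by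
      intro h
      have h3 := hR'.eigenvectorBasis.orthonormal.ne_zero i
      exact h3 (by ext j; exact congrFun h j)
    have h3 : (1 - hR'.eigenvalues i * hR'.eigenvalues i) •
        ((hR'.eigenvectorBasis i : EuclideanSpace ℝ (Fin m)) : Fin m → ℝ) = 0 := by
      rw [sub_smul, one_smul, ← h2, sub_self]
    have h4 := (smul_eq_zero.1 h3).resolve_right hne
    exact mul_self_eq_one_iff.1 (by simpa using (sub_eq_zero.1 h4).symm)
  have h1 : R.charpoly.roots.filter (fun x => 0 < x) = Multiset.replicate u 1 := by
    rw [Multiset.eq_replicate]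
    refine ⟨hp, fun x hx => ?_⟩
    rw [Multiset.mem_filter] at hx
    rcases hroot x hx.1 with h | h
    · exact h
    · linarith [hx.2]
  have h2 : R.charpoly.roots.filter (fun x => x < 0) = Multiset.replicate (m - u) (-1) := by
    rw [Multiset.eq_replicate]
    refine ⟨hn, fun x hx => ?_⟩
    rw [Multiset.mem_filter] at hx
    rcases hroot x hx.1 with h | h
    · linarith [hx.2]
    · exact h
  rw [← Multiset.filter_add_not (fun x => 0 < x) R.charpoly.roots, h1, ← h2]
  congr 1
  refine Multiset.filter_congr fun x hx => ?_
  rcases hroot x hx with h | h <;> simp [h]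

theorem mem_O_inter_GLSym_iff {u : ℕ} (hu : u ≤ m) {R : Matrix (Fin m) (Fin m) ℝ} :
    R ∈ O m ∩ GLSym m u ↔
      ∃ g ∈ Matrix.orthogonalGroup (Fin m) ℝ, R = g * signMatrix m u * g.transpose := by
  constructor
  · intro hR
    have hD : signMatrix m u ∈ O m ∩ GLSym m u := by
      simpa using conj_signMatrix_mem hu (one_mem (Matrix.orthogonalGroup (Fin m) ℝ))
    refine exists_orthogonal_conj_of_charpoly_eq (signMatrix_isSymm m u) hR.2.1
      (charpoly_eq_of_roots_eq ?_ ?_)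
    · rw [roots_charpoly_of_mem hR, Multiset.card_add, Multiset.card_replicate,
        Multiset.card_replicate]
      omega
    · rw [roots_charpoly_of_mem hR, roots_charpoly_of_mem hD]
  · rintro ⟨g, hg, rfl⟩
    exact conj_signMatrix_mem hu hg

end Signs

/-! ### Block sums, the centralizer of `J_M`, and the spectrum of the auxiliary form -/

section Blocks

variable {p n : ℕ} {h : Fin p → ℕ} {hn : ∑ i, h i = n}

theorem blockSum_mul (A B : (i : Fin p) → Matrix (Fin (h i)) (Fin (h i)) ℝ) :
    blockSum hn A * blockSum hn B = blockSum hn fun i => A i * B i := by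
  simp only [blockSum, Matrix.reindex_apply, Matrix.submatrix_mul_equiv, Matrix.blockDiagonal'_mul]

theorem blockSum_transpose (A : (i : Fin p) → Matrix (Fin (h i)) (Fin (h i)) ℝ) :
    (blockSum hn A).transpose = blockSum hn fun i => (A i).transpose := by
  simp only [blockSum, Matrix.transpose_reindex, Matrix.blockDiagonal'_transpose]

theorem blockSum_one : blockSum hn (fun i => (1 : Matrix (Fin (h i)) (Fin (h i)) ℝ)) = 1 := by
  rw [blockSum]
  change Matrix.reindex _ _ (Matrix.blockDiagonal' 1) = 1
  rw [Matrix.blockDiagonal'_one, Matrix.reindex_apply, Matrix.submatrix_one_equiv]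

theorem blockSum_injective :
    Function.Injective (blockSum hn : ((i : Fin p) → Matrix (Fin (h i)) (Fin (h i)) ℝ) → _) :=
  (Matrix.reindex _ _).injective.comp Matrix.blockDiagonal'_injective

/-- A matrix that commutes with `⊕ λᵢ I`, with distinct `λᵢ`, is block diagonal. -/
theorem exists_eq_blockSum_of_commute {lam : Fin p → ℝ} (hlam : Function.Injective lam)
    {X : Matrix (Fin n) (Fin n) ℝ} (hX : Commute (jordanForm hn lam) X) :
    ∃ B : (i : Fin p) → Matrix (Fin (h i)) (Fin (h i)) ℝ, X = blockSum hn B := by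
  set e := finSigmaFinEquiv.trans (finCongr hn) with he
  have hJ : jordanForm hn lam = Matrix.reindex e e (Matrix.diagonal fun k => lam k.1) := by
    rw [jordanForm, blockSum, ← Matrix.blockDiagonal'_diagonal (fun i (_ : Fin (h i)) => lam i)]
    congr 2
    ext i : 1
    rw [Matrix.smul_one_eq_diagonal]
  set Y := Matrix.reindex e.symm e.symm X with hY
  have hXY : X = Matrix.reindex e e Y := by
    ext i j
    simp [hY]
  have hcomm : Matrix.diagonal (fun k : (i : Fin p) × Fin (h i) => lam k.1) * Y =
      Y * Matrix.diagonal fun k => lam k.1 := by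
    have h1 := hX.eq
    rw [hJ, hXY] at h1
    simp only [Matrix.reindex_apply, Matrix.submatrix_mul_equiv] at h1
    exact (Matrix.reindex e e).injective h1
  refine ⟨fun i => Matrix.of fun a b => Y ⟨i, a⟩ ⟨i, b⟩, ?_⟩
  rw [blockSum, hXY]
  congr 1
  ext ⟨i, a⟩ ⟨j, b⟩
  rw [Matrix.blockDiagonal'_apply]
  split_ifs with hij
  · change i = j at hij
    subst hij
    rfl
  · have h1 := congrFun (congrFun hcomm ⟨i, a⟩) ⟨j, b⟩
    rw [Matrix.diagonal_mul, Matrix.mul_diagonal] at h1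
    have h2 : (lam i - lam j) * Y ⟨i, a⟩ ⟨j, b⟩ = 0 := by
      rw [sub_mul, h1]; ring
    exact (mul_eq_zero.1 h2).resolve_left (sub_ne_zero.2 fun h => hij (hlam h))

theorem exists_blockSum_of_orthCentralizer {lam : Fin p → ℝ} (hlam : Function.Injective lam)
    (X : orthCentralizer (jordanForm hn lam)) :
    ∃ B : (i : Fin p) → Matrix (Fin (h i)) (Fin (h i)) ℝ,
      (∀ i, B i ∈ Matrix.orthogonalGroup (Fin (h i)) ℝ) ∧ orthIncl _ X = blockSum hn B := by
  obtain ⟨B, hB⟩ := exists_eq_blockSum_of_commute hlam (commute_orthIncl X)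
  refine ⟨B, fun i => ?_, hB⟩
  have h1 := transpose_mul_orthIncl X
  rw [hB, blockSum_transpose, blockSum_mul, ← blockSum_one (hn := hn)] at h1
  exact (Matrix.mem_orthogonalGroup_iff' _ _).2 (congrFun (blockSum_injective h1) i)

theorem exists_orthCentralizer_of_blockSum {lam : Fin p → ℝ}
    {B : (i : Fin p) → Matrix (Fin (h i)) (Fin (h i)) ℝ}
    (hB : ∀ i, B i ∈ Matrix.orthogonalGroup (Fin (h i)) ℝ) :
    ∃ X : orthCentralizer (jordanForm hn lam), orthIncl _ X = blockSum hn B := by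
  refine ⟨⟨⟨blockSum hn B, (Matrix.mem_orthogonalGroup_iff' _ _).2 ?_⟩, ?_⟩, rfl⟩
  · rw [blockSum_transpose, blockSum_mul, ← blockSum_one (hn := hn)]
    congr 1
    ext i : 1
    exact (Matrix.mem_orthogonalGroup_iff' _ _).1 (hB i)
  · change jordanForm hn lam * blockSum hn B = blockSum hn B * jordanForm hn lam
    rw [jordanForm, blockSum_mul, blockSum_mul]
    simp

variable {lam : Fin p → ℝ} {u : Fin p → ℕ}

theorem auxForm_eq :
    auxForm hn lam u = blockSum hn fun i => √(lam i) • signMatrix (h i) (u i) := rfl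

theorem auxForm_isSymm : (auxForm hn lam u).IsSymm := by
  rw [auxForm_eq, Matrix.IsSymm, blockSum_transpose]
  congr 1
  ext i : 1
  rw [Matrix.transpose_smul, (signMatrix_isSymm _ _).eq]

theorem auxForm_mul_self (hpos : ∀ i, 0 < lam i) :
    auxForm hn lam u * auxForm hn lam u = jordanForm hn lam := by
  rw [auxForm_eq, blockSum_mul, jordanForm]
  congr 1
  ext i : 1
  rw [smul_mul_smul_comm, signMatrix_mul_self, Real.mul_self_sqrt (hpos i).le]

theorem isUnit_auxForm (hpos : ∀ i, 0 < lam i) : IsUnit (auxForm hn lam u) := by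
  refine IsUnit.of_mul_eq_one (blockSum hn fun i => (√(lam i))⁻¹ • signMatrix (h i) (u i)) ?_
  rw [auxForm_eq, blockSum_mul, ← blockSum_one (hn := hn)]
  congr 1
  ext i : 1
  rw [smul_mul_smul_comm, signMatrix_mul_self, mul_inv_cancel₀ (Real.sqrt_pos.2 (hpos i)).ne',
    one_smul]

theorem roots_charpoly_auxForm :
    (auxForm hn lam u).charpoly.roots = Finset.univ.val.map
      (fun k : (i : Fin p) × Fin (h i) => √(lam k.1) * if (k.2 : ℕ) < u k.1 then 1 else -1) := by
  rw [← roots_charpoly_diagonal, auxForm, blockSum, Matrix.charpoly_reindex]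
  rw [← Matrix.blockDiagonal'_diagonal
    (fun i (a : Fin (h i)) => √(lam i) * if (a : ℕ) < u i then 1 else -1)]
  congr 3
  ext i : 1
  rw [← Matrix.diagonal_smul]
  rfl

theorem card_filter_roots_auxForm (q : ℝ → Prop) [DecidablePred q] :
    ((auxForm hn lam u).charpoly.roots.filter q).card = ∑ i,
      (Finset.univ.filter fun a : Fin (h i) =>
        q (√(lam i) * if (a : ℕ) < u i then 1 else -1)).card := by
  rw [roots_charpoly_auxForm, Multiset.filter_map, Multiset.card_map]
  change (Finset.univ.filter _).card = _
  simp only [Finset.card_filter, Function.comp_apply]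
  rw [Fintype.sum_sigma]

theorem card_roots_auxForm : Multiset.card (auxForm hn lam u).charpoly.roots = n := by
  rw [roots_charpoly_auxForm, Multiset.card_map]
  simp [hn]

/-- The `√λᵢ` are positive and distinct, so only block `i` contributes to the multiplicities of
`±√λᵢ`. -/
theorem count_roots_auxForm (hlam : Function.Injective lam) (hpos : ∀ i, 0 < lam i)
    (hu : ∀ i, u i ≤ h i) (i : Fin p) :
    (auxForm hn lam u).charpoly.roots.count (√(lam i)) = u i ∧
      (auxForm hn lam u).charpoly.roots.count (-√(lam i)) = h i - u i := by
  have hsq : ∀ j, 0 < √(lam j) := fun j => Real.sqrt_pos.2 (hpos j)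
  have hinj : ∀ j, √(lam i) = √(lam j) → j = i := fun j hj =>
    (hlam ((Real.sqrt_inj (hpos i).le (hpos j).le).1 hj)).symm
  constructor
  · rw [Multiset.count, Multiset.countP_eq_card_filter, card_filter_roots_auxForm,
      Finset.sum_eq_single i]
    · refine Eq.trans ?_ (card_filter_lt (hu i))
      congr 1
      ext a
      have := hsq i
      simp only [Finset.mem_filter, Finset.mem_univ, true_and]
      split_ifs with ha
      · simp [ha]
      · simp only [ha, iff_false]
        linarith
    · intro j _ hj
      rw [Finset.card_eq_zero, Finset.filter_eq_empty_iff]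
      intro a _ ha
      have h1 := hsq i
      have h2 := hsq j
      split_ifs at ha
      · exact hj (hinj j (by simpa using ha))
      · linarith
    · simp
  · rw [Multiset.count, Multiset.countP_eq_card_filter, card_filter_roots_auxForm,
      Finset.sum_eq_single i]
    · refine Eq.trans ?_ (card_filter_not_lt (hu i))
      congr 1
      ext a
      have := hsq i
      simp only [Finset.mem_filter, Finset.mem_univ, true_and]
      split_ifs with ha
      · simp only [ha, not_true, iff_false]
        linarith
      · simp [ha]
    · intro j _ hj
      rw [Finset.card_eq_zero, Finset.filter_eq_empty_iff]
      intro a _ ha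
      have h1 := hsq i
      have h2 := hsq j
      split_ifs at ha
      · linarith
      · exact hj (hinj j (by simpa using ha))
    · simp

theorem charpoly_eq_auxForm_iff (hlam : Function.Injective lam) (hpos : ∀ i, 0 < lam i)
    (hu : ∀ i, u i ≤ h i) {Y : Matrix (Fin n) (Fin n) ℝ} :
    (∀ i, Y.charpoly.rootMultiplicity (√(lam i)) = u i ∧
      Y.charpoly.rootMultiplicity (-√(lam i)) = h i - u i) ↔
      Y.charpoly = (auxForm hn lam u).charpoly := by
  constructor
  · intro hY
    refine charpoly_eq_of_roots_eq card_roots_auxForm (Eq.symm ?_)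
    -- The prescribed multiplicities give inclusion of the root multisets; the smaller already has
    -- `n` elements and the larger has at most `n`.
    refine Multiset.eq_of_le_of_card_le (Multiset.le_iff_count.2 fun x => ?_) ?_
    · by_cases hx : x ∈ (auxForm hn lam u).charpoly.roots
      · rw [roots_charpoly_auxForm, Multiset.mem_map] at hx
        obtain ⟨⟨i, a⟩, -, rfl⟩ := hx
        have h1 := count_roots_auxForm (hn := hn) hlam hpos hu i
        have h2 := hY i
        dsimp only
        split_ifs
        · rw [mul_one, h1.1, Polynomial.count_roots, h2.1]
        · rw [mul_neg_one, h1.2, Polynomial.count_roots, h2.2]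
      · rw [Multiset.count_eq_zero_of_notMem hx]
        exact Nat.zero_le _
    · rw [card_roots_auxForm]
      refine (Polynomial.card_roots' _).trans ?_
      rw [Matrix.charpoly_natDegree_eq_dim, Fintype.card_fin]
  · intro hY i
    rw [hY, ← Polynomial.count_roots, ← Polynomial.count_roots]
    exact count_roots_auxForm hlam hpos hu i

theorem auxForm_signature (hpos : ∀ i, 0 < lam i) (hu : ∀ i, u i ≤ h i) :
    ((auxForm hn lam u).charpoly.roots.filter (fun x => 0 < x)).card = ∑ i, u i ∧
      ((auxForm hn lam u).charpoly.roots.filter (fun x => x < 0)).card = n - ∑ i, u i := by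
  have hsq : ∀ j, 0 < √(lam j) := fun j => Real.sqrt_pos.2 (hpos j)
  constructor
  · rw [card_filter_roots_auxForm]
    refine Finset.sum_congr rfl fun i _ => Eq.trans ?_ (card_filter_lt (hu i))
    congr 1
    ext a
    have := hsq i
    simp only [Finset.mem_filter, Finset.mem_univ, true_and]
    split_ifs with ha
    · simp [ha, this]
    · simp only [ha, iff_false]
      linarith
  · rw [card_filter_roots_auxForm, ← hn, ← Finset.sum_tsub_distrib _ fun i _ => hu i]
    refine Finset.sum_congr rfl fun i _ => Eq.trans ?_ (card_filter_not_lt (hu i))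
    congr 1
    ext a
    have := hsq i
    simp only [Finset.mem_filter, Finset.mem_univ, true_and]
    split_ifs with ha
    · simp only [ha, not_true, iff_false]
      linarith
    · simp [ha, this]

end Blocks

/-! ### The stratum as an orbit and as a block sum -/

section Stratum

variable {p n : ℕ} {h u : Fin p → ℕ} {hn : ∑ i, h i = n} {lam : Fin p → ℝ}
  {M Q : Matrix (Fin n) (Fin n) ℝ}

theorem stratum_eq_orbit (hlam : Function.Injective lam) (hpos : ∀ i, 0 < lam i)
    (hu : ∀ i, u i ≤ h i) (hQ : Q ∈ Matrix.orthogonalGroup (Fin n) ℝ)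
    (hM : M = Q * jordanForm hn lam * Q.transpose) :
    stratum M lam h u = {Y | ∃ X : orthCentralizer (jordanForm hn lam),
      Y = Q * orthIncl _ X * auxForm hn lam u * (orthIncl _ X).transpose * Q.transpose} := by
  have hT : (auxForm hn lam u).IsSymm := auxForm_isSymm
  have hQ1 : Q.transpose * Q = 1 := (Matrix.mem_orthogonalGroup_iff' _ _).1 hQ
  have hQ2 : Q * Q.transpose = 1 := (Matrix.mem_orthogonalGroup_iff _ _).1 hQ
  have hTT : auxForm hn lam u * auxForm hn lam u = jordanForm hn lam := auxForm_mul_self hpos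
  have hmem : ∀ Y, Y ∈ stratum M lam h u ↔
      (Y * Y = M ∧ Y.IsSymm) ∧ Y.charpoly = (auxForm hn lam u).charpoly := by
    intro Y
    rw [← charpoly_eq_auxForm_iff hlam hpos hu, ← pow_two]
    rfl
  rw [← hTT] at hM ⊢
  subst hM
  generalize auxForm hn lam u = T at *
  ext Y
  rw [hmem]
  constructor
  · rintro ⟨⟨hY, hs⟩, hc⟩
    have hYZ : Y = Q * (Q.transpose * Y * Q) * Q.transpose := by
      calc Y = (Q * Q.transpose) * Y * (Q * Q.transpose) := by rw [hQ2, one_mul, mul_one]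
        _ = _ := by noncomm_ring
    have hZs : (Q.transpose * Y * Q).IsSymm := by
      simpa using isSymm_conj hs Q.transpose
    have hZ : Q.transpose * Y * Q * (Q.transpose * Y * Q) = T * T := by
      calc _ = Q.transpose * Y * (Q * Q.transpose) * Y * Q := by noncomm_ring
        _ = Q.transpose * (Y * Y) * Q := by rw [hQ2]; noncomm_ring
        _ = T * T := by rw [hY, conj_cancel hQ1]
    have hZc : (Q.transpose * Y * Q).charpoly = T.charpoly := by
      rw [Matrix.charpoly_mul_comm, ← mul_assoc, hQ2, one_mul, hc]
    obtain ⟨X, hX⟩ := exists_orthCentralizer_conj hT hZs hZ hZc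
    refine ⟨X, ?_⟩
    rw [hYZ, hX]
    noncomm_ring
  · rintro ⟨X, rfl⟩
    have hX1 := transpose_mul_orthIncl X
    have hX2 := orthIncl_mul_transpose X
    have hX3 := (commute_orthIncl X).eq
    generalize orthIncl (T * T) X = A at *
    have hP : (Q * A).transpose * (Q * A) = 1 := by
      rw [Matrix.transpose_mul, mul_assoc, ← mul_assoc Q.transpose, hQ1, one_mul, hX1]
    have hY : Q * A * T * A.transpose * Q.transpose = Q * A * T * (Q * A).transpose := by
      rw [Matrix.transpose_mul]
      noncomm_ring
    rw [hY]
    refine ⟨⟨?_, isSymm_conj hT _⟩, ?_⟩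
    · calc _ = Q * A * T * ((Q * A).transpose * (Q * A)) * T * (Q * A).transpose := by
            noncomm_ring
        _ = Q * (A * (T * T)) * (Q * A).transpose := by rw [hP]; noncomm_ring
        _ = Q * (T * T) * (A * A.transpose) * Q.transpose := by
            rw [← hX3, Matrix.transpose_mul]
            noncomm_ring
        _ = _ := by rw [hX2, mul_one]
    · rw [Matrix.charpoly_mul_comm, ← mul_assoc, hP, one_mul]

theorem stratum_jordanForm_eq_orbit (hlam : Function.Injective lam) (hpos : ∀ i, 0 < lam i)
    (hu : ∀ i, u i ≤ h i) :
    stratum (jordanForm hn lam) lam h u = {Y | ∃ X : orthCentralizer (jordanForm hn lam),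
      Y = orthIncl _ X * auxForm hn lam u * (orthIncl _ X).transpose} := by
  simpa using stratum_eq_orbit (M := jordanForm hn lam) hlam hpos hu
    (one_mem (Matrix.orthogonalGroup (Fin n) ℝ)) (by simp)

/-- Group elements are block sums of orthogonal matrices, so the orbit is formed block by block;
within a block the orbit of the sign matrix is `O ∩ GLSym` by `mem_O_inter_GLSym_iff`. -/
theorem stratum_jordanForm_eq_blockSumSet (hlam : Function.Injective lam)
    (hpos : ∀ i, 0 < lam i) (hu : ∀ i, u i ≤ h i) :
    stratum (jordanForm hn lam) lam h u =
      blockSumSet hn (fun i => √(lam i) • (O (h i) ∩ GLSym (h i) (u i))) := by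
  have hconj : ∀ B : (i : Fin p) → Matrix (Fin (h i)) (Fin (h i)) ℝ,
      blockSum hn B * auxForm hn lam u * (blockSum hn B).transpose =
        blockSum hn fun i => √(lam i) • (B i * signMatrix (h i) (u i) * (B i).transpose) := by
    intro B
    rw [auxForm_eq, blockSum_transpose, blockSum_mul, blockSum_mul]
    simp only [mul_smul_comm, smul_mul_assoc]
  rw [stratum_jordanForm_eq_orbit hlam hpos hu]
  ext Y
  constructor
  · rintro ⟨X, rfl⟩
    obtain ⟨B, hB, hX⟩ := exists_blockSum_of_orthCentralizer hlam X
    rw [hX, hconj]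
    exact ⟨_, fun i => Set.smul_mem_smul_set ((mem_O_inter_GLSym_iff (hu i)).2 ⟨B i, hB i, rfl⟩),
      rfl⟩
  · rintro ⟨C, hC, rfl⟩
    have hC' : ∀ i, ∃ g ∈ Matrix.orthogonalGroup (Fin (h i)) ℝ,
        C i = √(lam i) • (g * signMatrix (h i) (u i) * g.transpose) := by
      intro i
      obtain ⟨R, hR, hRC⟩ := hC i
      obtain ⟨g, hg, rfl⟩ := (mem_O_inter_GLSym_iff (hu i)).1 hR
      exact ⟨g, hg, hRC.symm⟩
    choose B hB hCB using hC'
    obtain ⟨X, hX⟩ := exists_orthCentralizer_of_blockSum (hn := hn) (lam := lam) hB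
    refine ⟨X, ?_⟩
    rw [hX, hconj]
    congr 1
    ext i : 1
    exact hCB i

theorem pos_of_range_eq_spectrum (hM : M.PosDef) (hspec : Set.range lam = spectrum ℝ M)
    (i : Fin p) : 0 < lam i := by
  have h1 : lam i ∈ spectrum ℝ M := hspec ▸ ⟨i, rfl⟩
  rw [hM.isHermitian.spectrum_real_eq_range_eigenvalues] at h1
  obtain ⟨j, hj⟩ := h1
  rw [← hj]
  exact hM.eigenvalues_pos j

theorem stratum_subset_GLSym (hM : IsUnit M) (hlam : Function.Injective lam)
    (hpos : ∀ i, 0 < lam i) (hn : ∑ i, h i = n) (hu : ∀ i, u i ≤ h i) :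
    stratum M lam h u ⊆ GLSym n (∑ i, u i) := by
  rintro Y ⟨⟨hY, hs⟩, hc⟩
  rw [charpoly_eq_auxForm_iff (hn := hn) hlam hpos hu] at hc
  refine ⟨hs, ?_, ?_⟩
  · rw [← hY] at hM
    exact (isUnit_pow_iff two_ne_zero).1 hM
  · rw [hc]
    exact auxForm_signature hpos hu

end Stratum

end SymRoots

end

/-! ### Assembly of the statement -/

theorem proposition3p2 {n p : ℕ} (M Q : Matrix (Fin n) (Fin n) ℝ)
    (lam : Fin p → ℝ) (h u : Fin p → ℕ)
    (hM : M.PosDef)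
    -- `λ₁ < ⋯ < λ_p` are the distinct eigenvalues of `M`, with multiplicities `h₁, …, h_p`
    (hlam : StrictMono lam)
    (hspec : Set.range lam = spectrum ℝ M)
    (hmult : ∀ i, M.charpoly.rootMultiplicity (lam i) = h i)
    (hn : ∑ i, h i = n)
    (hQ : Q ∈ Matrix.orthogonalGroup (Fin n) ℝ)
    (hMQ : M = Q * SymRoots.jordanForm hn lam * Q.transpose)
    (hu : ∀ i, u i ≤ h i) :
    SymRoots.stratum M lam h u =
      {Y | ∃ X : SymRoots.orthCentralizer (SymRoots.jordanForm hn lam),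
        Y = Q * SymRoots.orthIncl _ X * SymRoots.auxForm hn lam u *
          (SymRoots.orthIncl _ X).transpose * Q.transpose} ∧
    SymRoots.stratum M lam h u =
      SymRoots.congruence Q '' SymRoots.stratum (SymRoots.jordanForm hn lam) lam h u ∧
    SymRoots.stratum (SymRoots.jordanForm hn lam) lam h u =
      SymRoots.blockSumSet hn
        (fun i => √(lam i) • (SymRoots.O (h i) ∩ SymRoots.GLSym (h i) (u i))) ∧
    IsCompact (SymRoots.stratum M lam h u) ∧
    -- the stratum lies in `GLSym_n(u₁ + ⋯ + u_p)`, which is an open subset of `Sym_n`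
    SymRoots.stratum M lam h u ⊆ SymRoots.GLSym n (∑ i, u i) ∧
    IsOpen (SymRoots.inSym (SymRoots.GLSym n (∑ i, u i))) ∧
    -- the second group is contained in the first, so that the quotient below makes sense
    SymRoots.orthCentralizer (SymRoots.auxForm hn lam u) ≤
      SymRoots.orthCentralizer (SymRoots.jordanForm hn lam) ∧
    -- `C_{J_M} ∩ O_n` is an embedded submanifold of the space of matrices, the quotient is a
    -- homogeneous space, the stratum is an embedded submanifold; the last two are diffeomorphic
    ∃ (d k : ℕ)
      (G : SymRoots.EmbeddedStructure d (SymRoots.orthIncl (SymRoots.jordanForm hn lam)))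
      (GH : SymRoots.HomogeneousStructure d k G.charted
        ((SymRoots.orthCentralizer (SymRoots.auxForm hn lam u)).subgroupOf
          (SymRoots.orthCentralizer (SymRoots.jordanForm hn lam))))
      (S : SymRoots.EmbeddedStructure k
        (Subtype.val : SymRoots.inSym (SymRoots.stratum M lam h u) → SymRoots.Sym n)),
      SymRoots.AreDiffeomorphic k k GH.charted S.charted := by
  have hinj := hlam.injective
  have hpos := SymRoots.pos_of_range_eq_spectrum hM hspec
  have hQ1 : Q.transpose * Q = 1 := (Matrix.mem_orthogonalGroup_iff' _ _).1 hQ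
  have hstr := SymRoots.stratum_eq_orbit hinj hpos hu hQ hMQ
  have hTT : SymRoots.auxForm hn lam u * SymRoots.auxForm hn lam u = SymRoots.jordanForm hn lam :=
    SymRoots.auxForm_mul_self hpos
  have hT : (SymRoots.auxForm hn lam u).IsSymm := SymRoots.auxForm_isSymm
  have horb : ∀ X : SymRoots.orthCentralizer (SymRoots.jordanForm hn lam),
      ((SymRoots.orbitMap _ Q hT X : SymRoots.Sym n) : Matrix (Fin n) (Fin n) ℝ) =
        Q * SymRoots.orthIncl _ X * SymRoots.auxForm hn lam u *
          (SymRoots.orthIncl _ X).transpose * Q.transpose := by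
    intro X
    change _ * Matrix.transpose (_ * _) = _
    rw [Matrix.transpose_mul, ← mul_assoc]
  have hrange : SymRoots.inSym (SymRoots.stratum M lam h u) =
      Set.range (SymRoots.orbitMap (SymRoots.jordanForm hn lam) Q hT) := by
    ext Y
    constructor
    · intro hY
      have hY' : (Y : Matrix (Fin n) (Fin n) ℝ) ∈ SymRoots.stratum M lam h u := hY
      rw [hstr] at hY'
      obtain ⟨X, hX⟩ := hY'
      exact ⟨X, Subtype.ext ((horb X).trans hX.symm)⟩
    · rintro ⟨X, rfl⟩
      change _ ∈ SymRoots.stratum M lam h u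
      rw [hstr]
      exact ⟨X, horb X⟩
  refine ⟨hstr, ?_, SymRoots.stratum_jordanForm_eq_blockSumSet hinj hpos hu, ?_,
    SymRoots.stratum_subset_GLSym hM.isUnit hinj hpos hn hu, SymRoots.isOpen_inSym_GLSym _ _, ?_,
    SymRoots.exists_homogeneousStructure_areDiffeomorphic hT (SymRoots.isUnit_auxForm hpos) hQ1 hTT
      hrange⟩
  · rw [hstr, SymRoots.stratum_jordanForm_eq_orbit hinj hpos hu]
    ext Y
    constructor
    · rintro ⟨X, rfl⟩
      refine ⟨_, ⟨X, rfl⟩, ?_⟩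
      simp only [SymRoots.congruence, mul_assoc]
    · rintro ⟨_, ⟨X, rfl⟩, rfl⟩
      refine ⟨X, ?_⟩
      simp only [SymRoots.congruence, mul_assoc]
  · have hcomp := isCompact_range
      (continuous_subtype_val.comp (SymRoots.continuous_orbitMap (J := SymRoots.jordanForm hn lam)
        (Q := Q) hT))
    convert! hcomp using 1
    rw [hstr]
    ext Y
    constructor
    · rintro ⟨X, rfl⟩
      exact ⟨X, horb X⟩
    · rintro ⟨X, rfl⟩
      exact ⟨X, horb X⟩
  · intro X hX
    rw [← hTT]
    exact Commute.mul_left hX hX
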